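/- **Setting.** There are $m$ agents with identical dynamics $x_{i,t+1}=Ax_{i,t}+Bu_{i,t}+w_t$, $x_{i,1}=0$, where $x_{i,t}\in\mathbb R^{d_1}$, $u_{i,t}\in\mathbb R^{d_2}$, the matrices $A,B$ are known, and the noise $(w_t)_{t\ge 1}$ is arbitrary (adversarial) with $\|w_t\|\le W$; put $w_t=0$ for $t\le 0$. Norms of vectors are Euclidean and norms of matrices are spectral; $\|A\|,\|B\|\le\kappa$. The local costs $c_{i,t}:\mathbb R^{d_1}\times\mathbb R^{d_2}\to\mathbb R$ are arbitrary differentiable convex functions such that $\|\nabla c_{i,t}(x,u)\|\le G_cD$ whenever $\|x\|,\|u\|\le D$. The matrix $P\in\mathbb R^{m\times m}$ is symmetric and doubly stochastic, has a positive diagonal, and its graph is connected; $\beta$ is its second largest singular value ($\beta=0$ if $m=1$). A matrix $K$ is *$(\kappa,\gamma)$-strongly stable* ($\kappa>0$, $0<\gamma\le1$) if $\|K\|\le\kappa$ and $A-BK=QLQ^{-1}$ for some matrices $L,Q$ with $\|L\|\le1-\gamma$ and $\|Q\|,\|Q^{-1}\|\le\kappa$. Let $\mathcal K$ be the set of all such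 matrices, and let $K\in\mathcal K$ be known to all agents. **Algorithm.** Given $T$, $\eta$ and $H\ge1$, let $\mathcal M$ be the set of all $M=(M^{[0]},\dots,M^{[H-1]})$, $M^{[k]}\in\mathbb R^{d_2\times d_1}$, with $\|M^{[k]}\|\le2\kappa^3(1-\gamma)^k$. All agents start from the same arbitrary $M_{i,1}\in\mathcal M$. For $t=1,\dots,T$, agent $i$ applies $$u_{i,t}=-Kx_{i,t}+\sum_{k=1}^{H}M_{i,t}^{[k-1]}w_{t-k},$$ recovers $w_t=x_{i,t+1}-Ax_{i,t}-Bu_{i,t}$, and sets $$M_{i,t+1}=\Pi_{\mathcal M}\Big(\sum_{j=1}^m[P]_{ji}M_{j,t}-\eta\,\nabla f_{i,t}(M_{i,t})\Big),$$ where $\Pi_{\mathcal M}$ and $\nabla$ are the projection and the gradient for the Frobenius inner product, and $f_{i,t}(M)=c_{i,t}(y_t(M),v_t(M))$ with $$y_t(M)=\sum_{i=0}^{2H}\Psi_i(M)\,w_{t-1-i},\qquad \Psi_i(M)=(A-BK)^i\,\mathbb 1_{i\le H}+\sum_{j=0}^{H}(A-BK)^jBM^{[i-j-1]}\,\mathbb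 1_{1\le i-j\le H},$$ $$v_t(M)=-Ky_t(M)+\sum_{k=1}^HM^{[k-1]}w_{t-k}.$$ **Theorem 1.** For every $\gamma\in(0,1]$ there is $h_0>0$, depending only on $\gamma$, such that for all $m,d_1,d_2,\kappa,W,G_c$ and all $0<\eta_1\le\eta_2$, $h_0\le h_1\le h_2$ there is a constant $C$ for which the following holds, for all $T\ge2$ and for all $A,B,K,P$, noises, costs and initial parameters as above. If the algorithm is run with $\eta_1/\sqrt T\le\eta\le\eta_2/\sqrt T$ and an integer $H\ge1$ with $h_1\log T\le H\le h_2\log T$ (that is, $\eta=\Theta(1/\sqrt T)$ and $H=\Theta(\log T)$ with a sufficiently large leading constant), then $\beta<1$, the minimum of $J_T$ over $\mathcal K$ is attained, and for every agent $j$ $$\sum_{t=1}^T\sum_{i=1}^mc_{i,t}(x_{j,t},u_{j,t})-\min_{K'\in\mathcal K}J_T(K')\le C\,\frac{\sqrt T\,\log T}{(1-\beta)^2}.$$ Here $J_T(K')=\sum_{t=1}^T\sum_{i=1}^mc_{i,t}(x_t,u_t)$ is evaluated along $u_t=-K'x_t$, $x_{t+1}=Ax_t+Bu_t+w_t$, $x_1=0$.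 -/

import Mathlib

open scoped Matrix.Norms.L2Operator

noncomputable section

namespace DistControl

/-- Column vectors, with the Euclidean norm. -/
abbrev Vec (n : ℕ) := EuclideanSpace ℝ (Fin n)

/-- State-action pairs, with the Euclidean norm of the concatenated vector. -/
abbrev Pair (d₁ d₂ : ℕ) := WithLp 2 (Vec d₁ × Vec d₂)

/-- The state-action pair `(x, u)`. -/
def pair {d₁ d₂ : ℕ} (x : Vec d₁) (u : Vec d₂) : Pair d₁ d₂ := WithLp.toLp 2 (x, u)

/-- Matrix-vector product on Euclidean vectors.  The norm `‖A‖` of a matrix is the spectral norm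
(the operator norm for Euclidean vectors) throughout. -/
def app {m n : ℕ} (A : Matrix (Fin m) (Fin n) ℝ) (x : Vec n) : Vec m := Matrix.toEuclideanLin A x

/-- `K` is a `(κ, γ)`-strongly stable linear policy (`u = -K x`) for the system `(A, B)`. -/
def StronglyStable {d₁ d₂ : ℕ} (κ γ : ℝ) (A : Matrix (Fin d₁) (Fin d₁) ℝ)
    (B : Matrix (Fin d₁) (Fin d₂) ℝ) (K : Matrix (Fin d₂) (Fin d₁) ℝ) : Prop :=
  0 < κ ∧ 0 < γ ∧ γ ≤ 1 ∧ ‖K‖ ≤ κ ∧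
    ∃ L Q : Matrix (Fin d₁) (Fin d₁) ℝ, IsUnit Q ∧ A - B * K = Q * L * Q⁻¹ ∧
      ‖L‖ ≤ 1 - γ ∧ ‖Q‖ ≤ κ ∧ ‖Q⁻¹‖ ≤ κ

/-! ### Network -/

/-- `P` is a symmetric doubly stochastic matrix with positive diagonal whose graph (distinct agents
`i`, `j` are neighbours when the weight `P i j` is positive) is connected. -/
structure IsNetwork {m : ℕ} (P : Matrix (Fin m) (Fin m) ℝ) : Prop where
  symm : P.IsSymm
  doublyStochastic : P ∈ doublyStochastic ℝ (Fin m)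
  diag_pos : ∀ i, 0 < P i i
  connected : (SimpleGraph.fromRel fun i j => 0 < P i j).Connected

/-- The second largest singular value of `P` (singular values are counted with multiplicity and
indexed from `0`; the value is `0` for a single agent). -/
def secondSingularValue {m : ℕ} (P : Matrix (Fin m) (Fin m) ℝ) : ℝ :=
  (Matrix.toEuclideanLin P).singularValues 1

/-! ### Disturbance feedback controllers -/

/-- Parameters `M = (M^[0], …, M^[H-1])`, each `M^[k]` a `d₂ × d₁` matrix, as a Euclidean space: its
norm is the Frobenius norm. -/
abbrev Param (H d₁ d₂ : ℕ) := EuclideanSpace ℝ (Fin H × Fin d₂ × Fin d₁)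

/-- The block `M^[k]`; it is read as zero for `k ≥ H`. -/
def block {H d₁ d₂ : ℕ} (M : Param H d₁ d₂) (k : ℕ) : Matrix (Fin d₂) (Fin d₁) ℝ :=
  Matrix.of fun a b => if h : k < H then M (⟨k, h⟩, a, b) else 0

/-- The feasible set: `‖M^[k]‖ ≤ 2 κ³ (1 - γ)^k` for `k = 0, …, H-1`. -/
def feasible (H d₁ d₂ : ℕ) (κ γ : ℝ) : Set (Param H d₁ d₂) :=
  {M | ∀ k < H, ‖block M k‖ ≤ 2 * κ ^ 3 * (1 - γ) ^ k}

/-- `N` is the Euclidean projection of `M` to the set `S`. -/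
def IsProjection {E : Type*} [NormedAddCommGroup E] (S : Set E) (M N : E) : Prop :=
  N ∈ S ∧ ∀ N' ∈ S, ‖M - N‖ ≤ ‖M - N'‖

/-- The past noise `w_{t-k}`, where times start at `1` and `w_s = 0` for `s ≤ 0`. -/
def past {n : ℕ} (w : ℕ → Vec n) (t k : ℕ) : Vec n := if k < t then w (t - k) else 0

/-- Second summand of the control of a disturbance feedback controller at time `t`:
`∑_{k=1}^{H} M^[k-1] w_{t-k}`. -/
def feedforward {H d₁ d₂ : ℕ} (M : Param H d₁ d₂) (w : ℕ → Vec d₁) (t : ℕ) : Vec d₂ :=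
  ∑ k ∈ Finset.Icc 1 H, app (block M (k - 1)) (past w t k)

/-- Disturbance-state transfer matrix `Ψ^{K,h}_i(M)` of a time-invariant parameter `M`. -/
def transfer {H d₁ d₂ : ℕ} (A : Matrix (Fin d₁) (Fin d₁) ℝ) (B : Matrix (Fin d₁) (Fin d₂) ℝ)
    (K : Matrix (Fin d₂) (Fin d₁) ℝ) (h : ℕ) (M : Param H d₁ d₂) (i : ℕ) :
    Matrix (Fin d₁) (Fin d₁) ℝ :=
  (if i ≤ h then (A - B * K) ^ i else 0) +
    ∑ j ∈ Finset.range (h + 1),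
      if j + 1 ≤ i ∧ i ≤ j + H then (A - B * K) ^ j * B * block M (i - j - 1) else 0

/-- Surrogate state `y_t(M) = ∑_{i=0}^{2H} Ψ^{K,H}_i(M) w_{t-1-i}`. -/
def surrogateState {H d₁ d₂ : ℕ} (A : Matrix (Fin d₁) (Fin d₁) ℝ)
    (B : Matrix (Fin d₁) (Fin d₂) ℝ) (K : Matrix (Fin d₂) (Fin d₁) ℝ) (w : ℕ → Vec d₁) (t : ℕ)
    (M : Param H d₁ d₂) : Vec d₁ :=
  ∑ i ∈ Finset.range (2 * H + 1), app (transfer A B K H M i) (past w t (i + 1))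

/-- Surrogate action `v_t(M) = -K y_t(M) + ∑_{k=1}^{H} M^[k-1] w_{t-k}`. -/
def surrogateAction {H d₁ d₂ : ℕ} (A : Matrix (Fin d₁) (Fin d₁) ℝ)
    (B : Matrix (Fin d₁) (Fin d₂) ℝ) (K : Matrix (Fin d₂) (Fin d₁) ℝ) (w : ℕ → Vec d₁) (t : ℕ)
    (M : Param H d₁ d₂) : Vec d₂ :=
  -app K (surrogateState A B K w t M) + feedforward M w t

/-- Surrogate cost `f_t(M) = c_t(y_t(M), v_t(M))`, for the cost function `ct = c_t`. -/
def surrogateCost {H d₁ d₂ : ℕ} (A : Matrix (Fin d₁) (Fin d₁) ℝ) (B : Matrix (Fin d₁) (Fin d₂) ℝ)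
    (K : Matrix (Fin d₂) (Fin d₁) ℝ) (w : ℕ → Vec d₁) (ct : Pair d₁ d₂ → ℝ) (t : ℕ)
    (M : Param H d₁ d₂) : ℝ :=
  ct (pair (surrogateState A B K w t M) (surrogateAction A B K w t M))

/-! ### The distributed algorithm -/

/-- A run over the rounds `1, …, T` of the distributed disturbance feedback controller for a known
system on the noise sequence `w` and the local costs `c i t`.  Agent `i` has state `x i t`, control
`u i t`, recovered noise `what i t` and parameter `M i t` at time `t`. -/
structure IsRun {m H d₁ d₂ : ℕ} (κ γ η : ℝ) (A : Matrix (Fin d₁) (Fin d₁) ℝ)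
    (B : Matrix (Fin d₁) (Fin d₂) ℝ) (K : Matrix (Fin d₂) (Fin d₁) ℝ)
    (P : Matrix (Fin m) (Fin m) ℝ) (T : ℕ) (w : ℕ → Vec d₁) (c : Fin m → ℕ → Pair d₁ d₂ → ℝ)
    (x : Fin m → ℕ → Vec d₁) (u : Fin m → ℕ → Vec d₂) (what : Fin m → ℕ → Vec d₁)
    (M : Fin m → ℕ → Param H d₁ d₂) : Prop where
  /-- all agents start in the zero state -/
  state_init : ∀ i, x i 1 = 0
  /-- the same arbitrary feasible initial parameter for all agents -/
  param_init : ∃ M₁ ∈ feasible H d₁ d₂ κ γ, ∀ i, M i 1 = M₁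
  control : ∀ i, ∀ t ∈ Finset.Icc 1 T, u i t = -app K (x i t) + feedforward (M i t) (what i) t
  dynamics : ∀ i, ∀ t ∈ Finset.Icc 1 T, x i (t + 1) = app A (x i t) + app B (u i t) + w t
  /-- the agent recovers the noise from the observed transition -/
  recover : ∀ i, ∀ t ∈ Finset.Icc 1 T, what i t = x i (t + 1) - app A (x i t) - app B (u i t)
  /-- communication, local gradient step and projection to the feasible set -/
  update : ∀ i, ∀ t ∈ Finset.Icc 1 T, IsProjection (feasible H d₁ d₂ κ γ)
    ((∑ j, P j i • M j t) - η • gradient (surrogateCost A B K (what i) (c i t) t) (M i t))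
    (M i (t + 1))

/-! ### Costs, benchmark -/

/-- A convex differentiable cost function with `‖∇c(x, u)‖ ≤ G D` whenever `‖x‖, ‖u‖ ≤ D`. -/
structure IsCost {d₁ d₂ : ℕ} (G : ℝ) (c : Pair d₁ d₂ → ℝ) : Prop where
  convex : ConvexOn ℝ Set.univ c
  differentiable : Differentiable ℝ c
  gradient_le : ∀ (D : ℝ) (x : Vec d₁) (u : Vec d₂), ‖x‖ ≤ D → ‖u‖ ≤ D →
    ‖gradient c (pair x u)‖ ≤ G * D

/-- Accumulated network cost `∑_{t=1}^{T} ∑_i c_{i,t}(x_t, u_t)` of a state-action sequence. -/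
def totalCost {m d₁ d₂ : ℕ} (c : Fin m → ℕ → Pair d₁ d₂ → ℝ) (T : ℕ) (x : ℕ → Vec d₁)
    (u : ℕ → Vec d₂) : ℝ :=
  ∑ t ∈ Finset.Icc 1 T, ∑ i, c i t (pair (x t) (u t))

/-- State at time `t ≥ 1` under the linear policy `u = -K x`, from the zero state at time `1`
(the value at time `0` is not used). -/
def linearState {d₁ d₂ : ℕ} (A : Matrix (Fin d₁) (Fin d₁) ℝ) (B : Matrix (Fin d₁) (Fin d₂) ℝ)
    (w : ℕ → Vec d₁) (K : Matrix (Fin d₂) (Fin d₁) ℝ) : ℕ → Vec d₁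
  | 0 => 0
  | 1 => 0
  | t + 2 => app A (linearState A B w K (t + 1)) + app B (-app K (linearState A B w K (t + 1))) +
      w (t + 1)

/-- `J_T(K)`: the accumulated network cost of the linear policy `u = -K x`. -/
def linearCost {m d₁ d₂ : ℕ} (A : Matrix (Fin d₁) (Fin d₁) ℝ) (B : Matrix (Fin d₁) (Fin d₂) ℝ)
    (w : ℕ → Vec d₁) (c : Fin m → ℕ → Pair d₁ d₂ → ℝ) (T : ℕ) (K : Matrix (Fin d₂) (Fin d₁) ℝ) :
    ℝ :=
  totalCost c T (linearState A B w K) fun t => -app K (linearState A B w K t)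

end DistControl

end

/-! The recovered noise is the true noise, so every controller in play, after subtracting the common
feedback `-K x`, is a feedforward sequence `z` driving `x (t+1) = (A - B K) x t + w t + B (z t)`.
Strong stability makes the influence of an input decay like `(1 - γ) ^ j`. By `surrogateState_eq`
the surrogate state is the unrolled recursion cut to its last `H + 1` inputs, with the parameter
frozen. Hence `StronglyStable.norm_state_sub_surrogateState_le` compares it with a true state at the
price of the drift of the inputs and a tail of order `(1 - γ) ^ H`. A linear policy `K'` is `K` plus
the feedforward `(K - K') x`; unrolling that state in the noise shows that the feasible parameter
`imitation` reproduces `K'` up to a similar tail.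

For agent `j` and the cost of agent `i` in one round, the excess over `K'` is a sum of four gaps:
true cost against surrogate cost at `M j` (drift and tail), surrogate cost at `M j` against `M i`
(disagreement), surrogate cost at `M i` against the imitation of `K'` (online learning), and
surrogate against true cost of `K'` (tail).

Disagreement is controlled by the network. `IsNetwork.norm_le_of_sum_eq_zero` makes mixing contract
deviations from the average by `β`, and each projected gradient step moves a parameter by at most
`η` times a gradient bound of order `√H`, so disagreement and drift are of order `η √H / (1 - β)`.
The surrogate cost is a convex function of an affine map of the parameter, so
`IsNetwork.regret_le_of_isProjection`, the usual potential argument for projected gradient descent,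
handles the learning gap.

`IsRun.regret_le` collects everything: up to constants the regret is `T η H / (1 - β) + T (1 - γ) ^
H + H / η`. The prescribed `η` and `H` make each term `O(√T log T)`, apart from the network factor;
the second power of `1 / (1 - β)` is only slack. -/

namespace DistControl

/-! ### Convexity and projections -/

/-- First-order condition for convexity. -/
theorem sub_le_fderiv_of_convexOn {E : Type*} [NormedAddCommGroup E] [NormedSpace ℝ E] {f : E → ℝ}
    (hf : ConvexOn ℝ Set.univ f) {p : E} (hd : DifferentiableAt ℝ f p) (q : E) :
    f p - f q ≤ fderiv ℝ f p (p - q) := by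
  have hg : ConvexOn ℝ Set.univ (fun s : ℝ => f (AffineMap.lineMap p q s)) := hf.comp_affineMap (AffineMap.lineMap (k := ℝ) p q)
  have hl : HasDerivAt (fun s : ℝ => AffineMap.lineMap p q s) (q - p) (0 : ℝ) :=
    AffineMap.hasDerivAt_lineMap
  have hp : AffineMap.lineMap p q (0 : ℝ) = p := AffineMap.lineMap_apply_zero p q
  have hd' : HasFDerivAt f (fderiv ℝ f p) (AffineMap.lineMap p q (0 : ℝ)) := by
    rw [hp]; exact hd.hasFDerivAt
  have h := hg.le_slope_of_hasDerivAt (Set.mem_univ 0) (Set.mem_univ 1) one_pos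
    (hd'.comp_hasDerivAt (0 : ℝ) hl)
  simp only [slope_def_field, AffineMap.lineMap_apply_zero, AffineMap.lineMap_apply_one, sub_zero,
    div_one, map_sub] at h
  rw [map_sub]
  linarith

/-- The variational inequality of the projection says that `a - b` and `z - b` form an obtuse angle,
and expanding the square gives the bound. Only points `z` of the set are needed: the comparator and
the mixed parameter. -/
theorem IsProjection.norm_sub_le {E : Type*} [NormedAddCommGroup E] [InnerProductSpace ℝ E]
    {S : Set E} (hS : Convex ℝ S) {a b z : E} (h : IsProjection S a b) (hz : z ∈ S) :
    ‖b - z‖ ≤ ‖a - z‖ := by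
  have hinf : ‖a - b‖ = ⨅ v : S, ‖a - v‖ := by
    have : Nonempty S := ⟨⟨b, h.1⟩⟩
    refine le_antisymm (le_ciInf fun v => h.2 v v.2) ?_
    exact ciInf_le (f := fun v : S => ‖a - v‖) ⟨0, by rintro _ ⟨v, rfl⟩; positivity⟩ ⟨b, h.1⟩
  have hi := (norm_eq_iInf_iff_real_inner_le_zero hS h.1).1 hinf z hz
  have hsq : ‖a - z‖ ^ 2 = ‖a - b‖ ^ 2 + 2 * inner ℝ (a - b) (b - z) + ‖b - z‖ ^ 2 := by
    rw [← norm_add_sq_real]; congr 2; abel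
  have hneg : inner ℝ (a - b) (b - z) = - inner ℝ (a - b) (z - b) := by
    rw [← inner_neg_right]; congr 1; abel
  refine le_of_sq_le_sq ?_ (norm_nonneg _)
  nlinarith [sq_nonneg ‖a - b‖]

/-! ### Mixing of a network -/

section Mixing

variable {m : ℕ} {P : Matrix (Fin m) (Fin m) ℝ}

theorem IsNetwork.nonneg (hP : IsNetwork P) (i j : Fin m) : 0 ≤ P i j :=
  (mem_doublyStochastic_iff_sum.1 hP.doublyStochastic).1 i j

theorem IsNetwork.sum_row (hP : IsNetwork P) (i : Fin m) : ∑ j, P i j = 1 :=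
  (mem_doublyStochastic_iff_sum.1 hP.doublyStochastic).2.1 i

theorem IsNetwork.sum_col (hP : IsNetwork P) (j : Fin m) : ∑ i, P i j = 1 :=
  (mem_doublyStochastic_iff_sum.1 hP.doublyStochastic).2.2 j

theorem toEuclideanLin_coord {n k : ℕ} (A : Matrix (Fin n) (Fin k) ℝ)
    (v : EuclideanSpace ℝ (Fin k)) (i : Fin n) :
    Matrix.toEuclideanLin A v i = ∑ j, A i j * v j := rfl

/-- A variance identity: row `i` of `P` is a probability distribution under which `v` has mean `(P
v) i`, and unit column sums turn the second moments into `‖v‖ ^ 2`. -/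
theorem IsNetwork.norm_sq_sub (hP : IsNetwork P) (v : EuclideanSpace ℝ (Fin m)) :
    ‖v‖ ^ 2 - ‖Matrix.toEuclideanLin P v‖ ^ 2 =
      ∑ i, ∑ j, P i j * (v j - Matrix.toEuclideanLin P v i) ^ 2 := by
  have hrow : ∀ i, ∑ j, P i j * (v j - Matrix.toEuclideanLin P v i) ^ 2 =
      (∑ j, P i j * v j ^ 2) - (Matrix.toEuclideanLin P v i) ^ 2 := by
    intro i
    set a := Matrix.toEuclideanLin P v i with ha
    have ha' : a = ∑ j, P i j * v j := rfl
    have : ∀ j, P i j * (v j - a) ^ 2 = P i j * v j ^ 2 - 2 * a * (P i j * v j) + a ^ 2 * P i j :=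
      fun j => by ring
    simp only [this, Finset.sum_add_distrib, Finset.sum_sub_distrib, ← Finset.mul_sum]
    rw [← ha', hP.sum_row]; ring
  simp only [hrow, Finset.sum_sub_distrib, EuclideanSpace.norm_sq_eq, Real.norm_eq_abs, sq_abs]
  rw [Finset.sum_comm]
  simp only [← Finset.sum_mul, hP.sum_col, one_mul]

theorem IsNetwork.norm_sq_le (hP : IsNetwork P) (v : EuclideanSpace ℝ (Fin m)) :
    ‖Matrix.toEuclideanLin P v‖ ^ 2 ≤ ‖v‖ ^ 2 := by
  have h : 0 ≤ ‖v‖ ^ 2 - ‖Matrix.toEuclideanLin P v‖ ^ 2 := by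
    rw [hP.norm_sq_sub]
    exact Finset.sum_nonneg fun i _ => Finset.sum_nonneg fun j _ =>
      mul_nonneg (hP.nonneg i j) (sq_nonneg _)
  linarith

/-- All variances vanish, so `v j = (P v) i` whenever `P i j > 0`. The positive diagonal gives `v i
= (P v) i` as well; hence neighbours agree, and connectedness spreads this to all agents. -/
theorem IsNetwork.eq_of_norm_sq_le (hP : IsNetwork P) {v : EuclideanSpace ℝ (Fin m)}
    (hv : ‖v‖ ^ 2 ≤ ‖Matrix.toEuclideanLin P v‖ ^ 2) (i j : Fin m) : v i = v j := by
  have h0 : ∑ i, ∑ j, P i j * (v j - Matrix.toEuclideanLin P v i) ^ 2 = 0 := by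
    rw [← hP.norm_sq_sub]; linarith [hP.norm_sq_le v]
  have hnn : ∀ i j, 0 ≤ P i j * (v j - Matrix.toEuclideanLin P v i) ^ 2 := fun i j =>
    mul_nonneg (hP.nonneg i j) (sq_nonneg _)
  have hz : ∀ i j, 0 < P i j → v j = Matrix.toEuclideanLin P v i := by
    intro i j hij
    have h1 := (Finset.sum_eq_zero_iff_of_nonneg
      (fun i _ => Finset.sum_nonneg fun j _ => hnn i j)).1 h0 i (Finset.mem_univ i)
    have h2 := (Finset.sum_eq_zero_iff_of_nonneg (fun j _ => hnn i j)).1 h1 j (Finset.mem_univ j)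
    have h3 := (mul_eq_zero.1 h2).resolve_left hij.ne'
    exact sub_eq_zero.1 (pow_eq_zero_iff two_ne_zero |>.1 h3)
  have hadj : ∀ a b, (SimpleGraph.fromRel fun i j => 0 < P i j).Adj a b → v a = v b := by
    intro a b hab
    rw [SimpleGraph.fromRel_adj] at hab
    rcases hab.2 with h | h
    · rw [hz a b h, hz a a (hP.diag_pos a)]
    · rw [hz b a h, hz b b (hP.diag_pos b)]
  obtain ⟨p⟩ := hP.connected.preconnected i j
  induction p with
  | nil => rfl
  | cons h _ ih => exact (hadj _ _ h).trans ih

theorem IsNetwork.secondSingularValue_nonneg : 0 ≤ secondSingularValue P :=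
  LinearMap.singularValues_nonneg _ _

variable (P) in
/-- Orthonormal eigenbasis of `Pᵀ P`. -/
theorem exists_gram_eigenbasis :
    ∃ (b : OrthonormalBasis (Fin m) ℝ (EuclideanSpace ℝ (Fin m))),
      (∀ k v, inner ℝ (Matrix.toEuclideanLin P (b k)) (Matrix.toEuclideanLin P v) =
        ‖Matrix.toEuclideanLin P (b k)‖ ^ 2 * inner ℝ (b k) v) ∧
      (∀ h : 1 < m, secondSingularValue P = ‖Matrix.toEuclideanLin P (b ⟨1, h⟩)‖) ∧
      (m ≤ 1 → secondSingularValue P = 0) ∧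
      Antitone fun k => ‖Matrix.toEuclideanLin P (b k)‖ ^ 2 := by
  set T := Matrix.toEuclideanLin P with hT
  have hn : Module.finrank ℝ (EuclideanSpace ℝ (Fin m)) = m := finrank_euclideanSpace_fin
  set hs := T.isSymmetric_adjoint_comp_self
  have hev : ∀ k v, inner ℝ (T (hs.eigenvectorBasis hn k)) (T v) =
      hs.eigenvalues hn k * inner ℝ (hs.eigenvectorBasis hn k) v := by
    intro k v
    rw [← LinearMap.adjoint_inner_left, ← LinearMap.comp_apply, hs.apply_eigenvectorBasis,
      inner_smul_left]
    simp
  have hnorm : ∀ k, hs.eigenvalues hn k = ‖T (hs.eigenvectorBasis hn k)‖ ^ 2 := by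
    intro k
    have h := hev k (hs.eigenvectorBasis hn k)
    rw [real_inner_self_eq_norm_sq, real_inner_self_eq_norm_sq,
      (hs.eigenvectorBasis hn).norm_eq_one] at h
    linarith
  refine ⟨hs.eigenvectorBasis hn, fun k v => by rw [hev, hnorm], fun h => ?_, fun h => ?_, ?_⟩
  · rw [secondSingularValue, ← hT, T.singularValues_of_lt hn h, hnorm,
      Real.sqrt_sq (norm_nonneg _)]
  · exact T.singularValues_of_finrank_le (hn.le.trans h)
  · simp only [← hnorm]
    exact hs.eigenvalues_antitone hn

theorem IsNetwork.secondSingularValue_lt_one (hP : IsNetwork P) : secondSingularValue P < 1 := by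
  obtain ⟨b, -, h1, h0, hanti⟩ := exists_gram_eigenbasis P
  by_cases hm : 1 < m
  · rw [h1 hm]
    -- Otherwise the two leading eigenvectors both keep their norm under `P`, hence both are
    -- constant; two nonzero constant vectors cannot be orthogonal.
    by_contra! hge
    have hge1 : 1 ≤ ‖Matrix.toEuclideanLin P (b ⟨1, hm⟩)‖ ^ 2 := by nlinarith
    have hge0 : 1 ≤ ‖Matrix.toEuclideanLin P (b ⟨0, by omega⟩)‖ ^ 2 :=
      hge1.trans (hanti (by simp [Fin.le_def]))
    have hc1 := hP.eq_of_norm_sq_le (v := b ⟨1, hm⟩) (by simpa using hge1)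
    have hc0 := hP.eq_of_norm_sq_le (v := b ⟨0, by omega⟩) (by simpa using hge0)
    have hort : inner ℝ (b ⟨0, by omega⟩) (b ⟨1, hm⟩) = 0 := b.orthonormal.2 (by simp)
    set i₀ : Fin m := ⟨0, by omega⟩
    have hne : ∀ k, (∀ i j, b k i = b k j) → b k i₀ ≠ 0 := by
      intro k hk h
      apply b.orthonormal.ne_zero k
      ext i
      rw [hk i i₀, h]; rfl
    have : inner ℝ (b i₀) (b ⟨1, hm⟩) = m * (b i₀ i₀ * b ⟨1, hm⟩ i₀) := by
      rw [PiLp.inner_apply]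
      simp only [fun i => hc0 i i₀, fun i => hc1 i i₀]
      simp [mul_comm]
    rw [this] at hort
    have hm0 : (m : ℝ) ≠ 0 := by positivity
    exact mul_ne_zero hm0 (mul_ne_zero (hne _ hc0) (hne _ hc1)) hort
  · rw [h0 (by omega)]; exact one_pos

theorem IsNetwork.norm_le_of_sum_eq_zero (hP : IsNetwork P) {v : EuclideanSpace ℝ (Fin m)}
    (hv : ∑ i, v i = 0) :
    ‖Matrix.toEuclideanLin P v‖ ^ 2 ≤ secondSingularValue P ^ 2 * ‖v‖ ^ 2 := by
  obtain ⟨b, hb, h1, h0, hanti⟩ := exists_gram_eigenbasis P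
  set T := Matrix.toEuclideanLin P with hT
  obtain ⟨i₀⟩ := hP.connected.nonempty
  have hmpos : 0 < m := i₀.pos
  set k₀ : Fin m := ⟨0, hmpos⟩
  set e : EuclideanSpace ℝ (Fin m) := WithLp.toLp 2 fun _ => (1 : ℝ) with he
  have hTe : T e = e := by
    ext i
    rw [hT, toEuclideanLin_coord]
    simp [he, hP.sum_row]
  have hinner_e : ∀ y : EuclideanSpace ℝ (Fin m), inner ℝ y e = ∑ i, y i := by
    intro y; simp [PiLp.inner_apply, he]
  have hTsum : ∀ y, inner ℝ (T y) e = inner ℝ y e := by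
    intro y
    rw [hinner_e, hinner_e]
    simp only [hT, toEuclideanLin_coord]
    rw [Finset.sum_comm]
    simp only [← Finset.sum_mul, hP.sum_col, one_mul]
  have hlam : ∀ k, k ≠ k₀ → ‖T (b k)‖ ^ 2 ≤ secondSingularValue P ^ 2 := by
    intro k hk
    have hk0 : (k : ℕ) ≠ 0 := fun h => hk (Fin.ext h)
    have hm : 1 < m := by have := k.isLt; omega
    rw [h1 hm]
    exact hanti (by rw [Fin.le_def]; show 1 ≤ (k : ℕ); omega)
  have hlt := hP.secondSingularValue_lt_one
  have hnn : 0 ≤ secondSingularValue P := IsNetwork.secondSingularValue_nonneg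
  -- `e` is fixed by `P` and by its transpose, so the eigenvector relation reads `⟨b k, e⟩ = ‖P (b
  -- k)‖ ^ 2 * ⟨b k, e⟩`, with a factor below one for `k ≠ k₀`.
  have hbe : ∀ k, k ≠ k₀ → inner ℝ (b k) e = 0 := by
    intro k hk
    have h := hb k e
    rw [hTe, hTsum] at h
    have hl : ‖T (b k)‖ ^ 2 < 1 := (hlam k hk).trans_lt (by nlinarith)
    have : (1 - ‖T (b k)‖ ^ 2) * inner ℝ (b k) e = 0 := by linarith
    exact (mul_eq_zero.1 this).resolve_left (by linarith)
  have hev : inner ℝ e v = (0 : ℝ) := by rw [real_inner_comm, hinner_e, hv]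
  -- Thus `e` is a nonzero multiple of `b k₀`, and a vector with zero sum has no component along the
  -- leading eigenvector.
  have hb0 : inner ℝ (b k₀) v = (0 : ℝ) := by
    have hexp := b.sum_inner_mul_inner e v
    rw [hev, Finset.sum_eq_single k₀ (fun k _ hk => by
      rw [real_inner_comm, hbe k hk, zero_mul]) (by simp)] at hexp
    refine (mul_eq_zero.1 hexp).resolve_left fun h => ?_
    have hee := b.sum_inner_mul_inner e e
    rw [Finset.sum_eq_single k₀ (fun k _ hk => by
      rw [real_inner_comm, hbe k hk, zero_mul]) (by simp), h, zero_mul, hinner_e] at hee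
    have hm0 : (m : ℝ) = 0 := by simpa [he] using hee.symm
    exact hmpos.ne' (Nat.cast_eq_zero.1 hm0)
  have hTv : ‖T v‖ ^ 2 = ∑ k, ‖T (b k)‖ ^ 2 * (inner ℝ (b k) v) ^ 2 := by
    have hrep : T v = ∑ k, inner ℝ (b k) v • T (b k) := by
      conv_lhs => rw [← b.sum_repr' v]
      simp
    rw [← real_inner_self_eq_norm_sq]
    conv_lhs => enter [2]; rw [hrep]
    rw [sum_inner]
    refine Finset.sum_congr rfl fun k _ => ?_
    rw [inner_smul_left, hb]; simp; ring
  have hvv : ‖v‖ ^ 2 = ∑ k, (inner ℝ (b k) v) ^ 2 := by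
    rw [← real_inner_self_eq_norm_sq, ← b.sum_inner_mul_inner]
    refine Finset.sum_congr rfl fun k _ => ?_
    rw [real_inner_comm, sq]
  rw [hTv, hvv, Finset.mul_sum]
  refine Finset.sum_le_sum fun k _ => ?_
  by_cases hk : k = k₀
  · rw [hk, hb0]; simp
  · exact mul_le_mul_of_nonneg_right (hlam k hk) (sq_nonneg _)

theorem IsNetwork.apply_comm (hP : IsNetwork P) (i j : Fin m) : P i j = P j i :=
  hP.symm.apply j i

/-- Mixing acts on each coordinate of the parameters separately, so the scalar contraction applies
coordinatewise; symmetry of `P` reconciles the weights `P j i` with the matrix action. -/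
theorem IsNetwork.sum_norm_sq_mix_le {ι : Type*} [Fintype ι] (hP : IsNetwork P)
    {z : Fin m → EuclideanSpace ℝ ι} (hz : ∑ i, z i = 0) :
    ∑ i, ‖∑ j, P j i • z j‖ ^ 2 ≤ secondSingularValue P ^ 2 * ∑ i, ‖z i‖ ^ 2 := by
  simp only [EuclideanSpace.norm_sq_eq, Real.norm_eq_abs, sq_abs]
  have hswap : ∀ F : Fin m → ι → ℝ, ∑ i, ∑ a, F i a = ∑ a, ∑ i, F i a := fun _ => Finset.sum_comm
  rw [hswap, hswap fun i a => z i a ^ 2, Finset.mul_sum]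
  refine Finset.sum_le_sum fun a _ => ?_
  have h := hP.norm_le_of_sum_eq_zero (v := WithLp.toLp 2 fun i => z i a) (by
    have := congrArg (fun y : EuclideanSpace ℝ ι => y a) hz
    simpa using this)
  simp only [EuclideanSpace.norm_sq_eq, Real.norm_eq_abs, sq_abs, toEuclideanLin_coord] at h
  have hcoord : ∀ i, (∑ j, P j i • z j) a = ∑ j, P i j * z j a := fun i => by
    simp [hP.apply_comm i]
  simpa only [hcoord] using h

end Mixing

/-! ### Distributed projected gradient descent -/

section Descent

variable {m : ℕ} {P : Matrix (Fin m) (Fin m) ℝ} {ι : Type*} [Fintype ι]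

/-- The average of a family of vectors. -/
noncomputable def average {E : Type*} [AddCommGroup E] [Module ℝ E] (z : Fin m → E) : E :=
  (m : ℝ)⁻¹ • ∑ j, z j

theorem norm_average_le {E : Type*} [NormedAddCommGroup E] [NormedSpace ℝ E] {z : Fin m → E}
    {ε : ℝ} (hm : 0 < m) (hz : ∀ i, ‖z i‖ ≤ ε) : ‖average z‖ ≤ ε := by
  have hm' : (0 : ℝ) < m := by exact_mod_cast hm
  have hsum : ‖∑ j, z j‖ ≤ m * ε := by
    simpa using norm_sum_le_of_le Finset.univ fun i _ => hz i
  rw [average, norm_smul, norm_inv, Real.norm_natCast, inv_mul_le_iff₀ hm']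
  exact hsum

/-- Quadratic deviation of a family of vectors from its average. -/
noncomputable def deviation (z : Fin m → EuclideanSpace ℝ ι) : ℝ :=
  ‖(WithLp.toLp 2 fun i => z i - average z : PiLp 2 fun _ : Fin m => EuclideanSpace ℝ ι)‖

theorem norm_sub_average_le_deviation (z : Fin m → EuclideanSpace ℝ ι) (i : Fin m) :
    ‖z i - average z‖ ≤ deviation z :=
  PiLp.norm_apply_le
    (WithLp.toLp 2 fun i => z i - average z : PiLp 2 fun _ : Fin m => EuclideanSpace ℝ ι) i

theorem norm_sub_le_deviation (z : Fin m → EuclideanSpace ℝ ι) (i j : Fin m) :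
    ‖z i - z j‖ ≤ 2 * deviation z := by
  have h : z i - z j = (z i - average z) - (z j - average z) := by abel
  rw [h]
  linarith [norm_sub_le (z i - average z) (z j - average z), norm_sub_average_le_deviation z i,
    norm_sub_average_le_deviation z j]

theorem deviation_const (hm : 0 < m) (a : EuclideanSpace ℝ ι) :
    deviation (fun _ : Fin m => a) = 0 := by
  have hm' : (m : ℝ) ≠ 0 := by positivity
  have h : average (fun _ : Fin m => a) = a := by
    rw [average]
    simp [← Nat.cast_smul_eq_nsmul ℝ, smul_smul, hm']
  rw [deviation, h]
  simp only [sub_self]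
  exact norm_zero

theorem IsNetwork.sum_mix {E : Type*} [AddCommGroup E] [Module ℝ E] (hP : IsNetwork P)
    (z : Fin m → E) : ∑ i, ∑ j, P j i • z j = ∑ j, z j := by
  rw [Finset.sum_comm]
  simp only [← Finset.sum_smul, hP.sum_row, one_smul]

theorem IsNetwork.mix_mem {E : Type*} [AddCommGroup E] [Module ℝ E] (hP : IsNetwork P)
    {S : Set E} (hS : Convex ℝ S) {z : Fin m → E} (hz : ∀ j, z j ∈ S) (i : Fin m) :
    ∑ j, P j i • z j ∈ S :=
  hS.sum_mem (fun j _ => hP.nonneg j i) (hP.sum_col i) fun j _ => hz j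

theorem IsNetwork.mix_sub {E : Type*} [AddCommGroup E] [Module ℝ E] (hP : IsNetwork P)
    (z : Fin m → E) (a : E) (i : Fin m) :
    ∑ j, P j i • z j - a = ∑ j, P j i • (z j - a) := by
  simp only [smul_sub, Finset.sum_sub_distrib, ← Finset.sum_smul, hP.sum_col, one_smul]

theorem IsNetwork.norm_mix_sub_le {E : Type*} [NormedAddCommGroup E] [NormedSpace ℝ E]
    (hP : IsNetwork P) {z : Fin m → E} {a : E} {R : ℝ} (h : ∀ j, ‖z j - a‖ ≤ R) (i : Fin m) :
    ‖∑ j, P j i • z j - a‖ ≤ R := by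
  rw [hP.mix_sub]
  calc ‖∑ j, P j i • (z j - a)‖ ≤ ∑ j, P j i * R := norm_sum_le_of_le _ fun j _ => by
        rw [norm_smul, Real.norm_of_nonneg (hP.nonneg j i)]
        exact mul_le_mul_of_nonneg_left (h j) (hP.nonneg j i)
    _ = R := by rw [← Finset.sum_mul, hP.sum_col, one_mul]

/-- Mixing preserves the average and contracts the rest by `β`. The perturbations, centred at their
own average, have size at most `2 ε` each, and the `ℓ²` sum over agents contributes `√m`. -/
theorem IsNetwork.deviation_le (hP : IsNetwork P) {z z' : Fin m → EuclideanSpace ℝ ι} {ε : ℝ}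
    (hε : 0 ≤ ε) (h : ∀ i, ‖z' i - ∑ j, P j i • z j‖ ≤ ε) :
    deviation z' ≤ secondSingularValue P * deviation z + 2 * √m * ε := by
  obtain ⟨i₀⟩ := hP.connected.nonempty
  have hm : 0 < m := i₀.pos
  have hm' : (m : ℝ) ≠ 0 := by positivity
  set e : Fin m → EuclideanSpace ℝ ι := fun i => z' i - ∑ j, P j i • z j with he
  have havg : average z' = average z + average e := by
    simp only [average, he, ← smul_add, Finset.sum_sub_distrib, hP.sum_mix]
    congr 1; abel
  have hsplit : (WithLp.toLp 2 fun i => z' i - average z' :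
      PiLp 2 fun _ : Fin m => EuclideanSpace ℝ ι) =
      (WithLp.toLp 2 fun i => ∑ j, P j i • (z j - average z)) +
        WithLp.toLp 2 fun i => e i - average e := by
    rw [← WithLp.toLp_add]
    congr 1
    funext i
    simp only [Pi.add_apply, ← hP.mix_sub, havg, he]
    abel
  have hβ : 0 ≤ secondSingularValue P := IsNetwork.secondSingularValue_nonneg
  have h1 : ‖(WithLp.toLp 2 fun i => ∑ j, P j i • (z j - average z) :
      PiLp 2 fun _ : Fin m => EuclideanSpace ℝ ι)‖ ≤ secondSingularValue P * deviation z := by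
    refine le_of_sq_le_sq ?_ (mul_nonneg hβ (norm_nonneg _))
    rw [mul_pow, deviation, PiLp.norm_sq_eq_of_L2, PiLp.norm_sq_eq_of_L2]
    refine hP.sum_norm_sq_mix_le ?_
    rw [Finset.sum_sub_distrib, average, Finset.sum_const, Finset.card_univ, Fintype.card_fin,
      ← Nat.cast_smul_eq_nsmul ℝ, smul_smul, mul_inv_cancel₀ hm', one_smul, sub_self]
  have h2 : ‖(WithLp.toLp 2 fun i => e i - average e :
      PiLp 2 fun _ : Fin m => EuclideanSpace ℝ ι)‖ ≤ 2 * √m * ε := by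
    refine le_of_sq_le_sq ?_ (by positivity)
    rw [PiLp.norm_sq_eq_of_L2]
    have hb : ∀ i, ‖e i - average e‖ ^ 2 ≤ (2 * ε) ^ 2 := fun i => by
      have : ‖e i - average e‖ ≤ 2 * ε := by
        linarith [norm_sub_le (e i) (average e), h i, norm_average_le hm h]
      gcongr
    calc ∑ i, ‖e i - average e‖ ^ 2 ≤ ∑ _i : Fin m, (2 * ε) ^ 2 :=
          Finset.sum_le_sum fun i _ => hb i
      _ = (2 * √m * ε) ^ 2 := by
          rw [Finset.sum_const, Finset.card_univ, Fintype.card_fin, nsmul_eq_mul, mul_pow, mul_pow,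
            mul_pow, Real.sq_sqrt (by positivity)]
          ring
  rw [deviation, hsplit]
  exact (norm_add_le _ _).trans (add_le_add h1 h2)

/-- Jensen for the squared norm, then double stochasticity. This keeps the potential of gradient
descent from growing in the communication step. -/
theorem IsNetwork.sum_norm_sq_mix_sub_le {E : Type*} [NormedAddCommGroup E] [NormedSpace ℝ E]
    (hP : IsNetwork P) (z : Fin m → E) (a : E) :
    ∑ i, ‖∑ j, P j i • z j - a‖ ^ 2 ≤ ∑ j, ‖z j - a‖ ^ 2 := by
  have hconv : ConvexOn ℝ Set.univ fun v : E => ‖v‖ ^ 2 :=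
    (convexOn_norm convex_univ).pow (fun _ _ => norm_nonneg _) 2
  calc ∑ i, ‖∑ j, P j i • z j - a‖ ^ 2 ≤ ∑ i, ∑ j, P j i * ‖z j - a‖ ^ 2 :=
        Finset.sum_le_sum fun i _ => by
          rw [hP.mix_sub]
          exact hconv.map_sum_le (fun j _ => hP.nonneg j i) (hP.sum_col i) fun _ _ => trivial
    _ = ∑ j, ‖z j - a‖ ^ 2 := hP.sum_mix fun j => ‖z j - a‖ ^ 2

variable {S : Set (EuclideanSpace ℝ ι)} {T : ℕ} {η G : ℝ} {M g : Fin m → ℕ → EuclideanSpace ℝ ι}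

theorem mem_of_isProjection
    (h1 : ∀ i, M i 1 ∈ S)
    (hstep : ∀ i, ∀ t ∈ Finset.Icc 1 T,
      IsProjection S ((∑ j, P j i • M j t) - η • g i t) (M i (t + 1)))
    (i : Fin m) {t : ℕ} (ht : t ∈ Finset.Icc 1 (T + 1)) : M i t ∈ S := by
  obtain ⟨ht1, ht2⟩ := Finset.mem_Icc.1 ht
  obtain rfl | ⟨s, rfl⟩ : t = 1 ∨ ∃ s, t = s + 1 := by
    right; exact ⟨t - 1, by omega⟩
  · exact h1 i
  · by_cases hs : s = 0
    · subst hs; exact h1 i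
    · exact (hstep i s (Finset.mem_Icc.2 ⟨by omega, by omega⟩)).1

theorem IsNetwork.norm_step_sub_mix_le (hP : IsNetwork P) (hS : Convex ℝ S) (hη : 0 ≤ η)
    (h1 : ∀ i, M i 1 ∈ S)
    (hstep : ∀ i, ∀ t ∈ Finset.Icc 1 T,
      IsProjection S ((∑ j, P j i • M j t) - η • g i t) (M i (t + 1)))
    (hg : ∀ i, ∀ t ∈ Finset.Icc 1 T, ‖g i t‖ ≤ G) (i : Fin m) {t : ℕ} (ht : t ∈ Finset.Icc 1 T) :
    ‖M i (t + 1) - ∑ j, P j i • M j t‖ ≤ η * G := by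
  obtain ⟨ht1, ht2⟩ := Finset.mem_Icc.1 ht
  have hmem := hP.mix_mem hS (z := fun j => M j t)
    (fun j => mem_of_isProjection h1 hstep j (Finset.mem_Icc.2 ⟨ht1, by omega⟩)) i
  -- The mixed parameter is itself feasible, so projecting cannot move the point farther from it
  -- than the gradient step did.
  refine ((hstep i t ht).norm_sub_le hS hmem).trans ?_
  rw [sub_sub_cancel_left, norm_neg, norm_smul, Real.norm_of_nonneg hη]
  exact mul_le_mul_of_nonneg_left (hg i t ht) hη

/-- The bound is the fixed point of `d ↦ β d + 2 √m η G`, and the common initial parameter starts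
the recursion at zero. -/
theorem IsNetwork.deviation_le_of_isProjection (hP : IsNetwork P) (hS : Convex ℝ S) (hη : 0 ≤ η)
    (hG : 0 ≤ G) (h1 : ∃ M₁ ∈ S, ∀ i, M i 1 = M₁)
    (hstep : ∀ i, ∀ t ∈ Finset.Icc 1 T,
      IsProjection S ((∑ j, P j i • M j t) - η • g i t) (M i (t + 1)))
    (hg : ∀ i, ∀ t ∈ Finset.Icc 1 T, ‖g i t‖ ≤ G) {t : ℕ} (ht1 : 1 ≤ t) (ht : t ≤ T + 1) :
    deviation (fun i => M i t) ≤ 2 * √m * (η * G) / (1 - secondSingularValue P) := by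
  obtain ⟨M₁, hM₁, hM1⟩ := h1
  have hβ : 0 < 1 - secondSingularValue P := sub_pos.2 hP.secondSingularValue_lt_one
  have hβ0 : 0 ≤ secondSingularValue P := IsNetwork.secondSingularValue_nonneg
  obtain ⟨i₀⟩ := hP.connected.nonempty
  induction t, ht1 using Nat.le_induction with
  | base =>
    simp only [hM1]
    rw [deviation_const i₀.pos]
    positivity
  | succ s hs ih =>
    have hsT : s ∈ Finset.Icc 1 T := Finset.mem_Icc.2 ⟨hs, by omega⟩
    have h := hP.deviation_le (z := fun i => M i s) (z' := fun i => M i (s + 1))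
      (mul_nonneg hη hG) fun i => hP.norm_step_sub_mix_le hS hη (fun i => by rwa [hM1 i]) hstep hg
        i hsT
    refine h.trans ?_
    have ih' := mul_le_mul_of_nonneg_left (ih (by omega)) hβ0
    refine (add_le_add_left ih' _).trans (le_of_eq ?_)
    field_simp
    ring

/-- Gradient descent with the potential `∑ i, ‖M i t - N‖ ^ 2`. The gradient is taken at `M i t` but
the step starts from the mixture; exchanging the two costs `G * R` per agent and round. -/
theorem IsNetwork.regret_le_of_isProjection (hP : IsNetwork P) (hS : Convex ℝ S) (hη : 0 < η)
    (hG : 0 ≤ G) {R : ℝ}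
    (hstep : ∀ i, ∀ t ∈ Finset.Icc 1 T,
      IsProjection S ((∑ j, P j i • M j t) - η • g i t) (M i (t + 1)))
    (hg : ∀ i, ∀ t ∈ Finset.Icc 1 T, ‖g i t‖ ≤ G)
    (hR : ∀ t ∈ Finset.Icc 1 T, ∀ i j, ‖M i t - M j t‖ ≤ R) {N : EuclideanSpace ℝ ι}
    (hN : N ∈ S) :
    ∑ t ∈ Finset.Icc 1 T, ∑ i, inner ℝ (g i t) (M i t - N) ≤
      (∑ i, ‖M i 1 - N‖ ^ 2) / (2 * η) + T * (m * (η * G ^ 2 / 2 + G * R)) := by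
  set V : ℕ → ℝ := fun t => ∑ i, ‖M i t - N‖ ^ 2 with hV
  have hround : ∀ t ∈ Finset.Icc 1 T, ∑ i, inner ℝ (g i t) (M i t - N) ≤
      (V t - V (t + 1)) / (2 * η) + m * (η * G ^ 2 / 2 + G * R) := by
    intro t ht
    have hi : ∀ i, 2 * η * inner ℝ (g i t) (M i t - N) ≤
        ‖∑ j, P j i • M j t - N‖ ^ 2 - ‖M i (t + 1) - N‖ ^ 2 +
          2 * η * (η * G ^ 2 / 2 + G * R) := by
      intro i
      set Z := ∑ j, P j i • M j t with hZ
      have hp := (hstep i t ht).norm_sub_le hS hN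
      have hp2 : ‖M i (t + 1) - N‖ ^ 2 ≤ ‖Z - η • g i t - N‖ ^ 2 := by gcongr
      have hexp : ‖Z - η • g i t - N‖ ^ 2 =
          ‖Z - N‖ ^ 2 - 2 * η * inner ℝ (g i t) (Z - N) + η ^ 2 * ‖g i t‖ ^ 2 := by
        have : Z - η • g i t - N = (Z - N) - η • g i t := by abel
        rw [this, norm_sub_sq_real, inner_smul_right, norm_smul, mul_pow, Real.norm_eq_abs, sq_abs,
          real_inner_comm]
        ring
      have hZM : ‖Z - M i t‖ ≤ R := hP.norm_mix_sub_le (fun j => hR t ht j i) i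
      have hsplit : inner ℝ (g i t) (Z - N) =
          inner ℝ (g i t) (M i t - N) + inner ℝ (g i t) (Z - M i t) := by
        rw [← inner_add_right]; congr 1; abel
      have hcs : -(G * R) ≤ inner ℝ (g i t) (Z - M i t) := by
        have h := abs_real_inner_le_norm (g i t) (Z - M i t)
        have h2 : ‖g i t‖ * ‖Z - M i t‖ ≤ G * R :=
          mul_le_mul (hg i t ht) hZM (norm_nonneg _) hG
        linarith [neg_abs_le (inner ℝ (g i t) (Z - M i t))]
      have hgsq : ‖g i t‖ ^ 2 ≤ G ^ 2 := by
        have := hg i t ht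
        gcongr
      have hcs' := mul_le_mul_of_nonneg_left hcs (by positivity : 0 ≤ 2 * η)
      have hgsq' := mul_le_mul_of_nonneg_left hgsq (sq_nonneg η)
      rw [hexp, hsplit] at hp2
      linarith
    have hsum := Finset.sum_le_sum fun i (_ : i ∈ Finset.univ) => hi i
    rw [← Finset.mul_sum, Finset.sum_add_distrib, Finset.sum_sub_distrib, Finset.sum_const,
      Finset.card_univ, Fintype.card_fin, nsmul_eq_mul] at hsum
    have hmix := hP.sum_norm_sq_mix_sub_le (fun j => M j t) N
    have : 2 * η * ∑ i, inner ℝ (g i t) (M i t - N) ≤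
        V t - V (t + 1) + 2 * η * (m * (η * G ^ 2 / 2 + G * R)) := by
      simp only [hV]; linarith
    rw [← sub_le_iff_le_add, le_div_iff₀ (by positivity)]
    linarith
  refine (Finset.sum_le_sum hround).trans ?_
  rw [Finset.sum_add_distrib, ← Finset.sum_div, Finset.sum_const, Nat.card_Icc,
    Nat.add_sub_cancel, nsmul_eq_mul]
  gcongr
  have htel : ∀ n : ℕ, ∑ t ∈ Finset.Icc 1 n, (V t - V (t + 1)) = V 1 - V (n + 1) := by
    intro n
    induction n with
    | zero => simp
    | succ n ih => rw [Finset.sum_Icc_succ_top (by omega), ih]; ring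
  rw [htel]
  have : 0 ≤ V (T + 1) := Finset.sum_nonneg fun i _ => sq_nonneg _
  linarith

end Descent

/-! ### Matrices acting on Euclidean vectors -/

section Matrices

variable {l m n : ℕ}

@[simp] theorem app_add (A : Matrix (Fin m) (Fin n) ℝ) (v v' : Vec n) :
    app A (v + v') = app A v + app A v' := map_add _ _ _

@[simp] theorem app_sub (A : Matrix (Fin m) (Fin n) ℝ) (v v' : Vec n) :
    app A (v - v') = app A v - app A v' := map_sub _ _ _

@[simp] theorem app_neg (A : Matrix (Fin m) (Fin n) ℝ) (v : Vec n) :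
    app A (-v) = -app A v := map_neg _ _

@[simp] theorem app_zero (A : Matrix (Fin m) (Fin n) ℝ) : app A (0 : Vec n) = 0 := map_zero _

theorem app_sum {α : Type*} (A : Matrix (Fin m) (Fin n) ℝ) (s : Finset α) (f : α → Vec n) :
    app A (∑ i ∈ s, f i) = ∑ i ∈ s, app A (f i) := map_sum _ _ _

theorem zero_app (v : Vec n) : app (0 : Matrix (Fin m) (Fin n) ℝ) v = 0 := by
  simp [app]

theorem add_app (A B : Matrix (Fin m) (Fin n) ℝ) (v : Vec n) :
    app (A + B) v = app A v + app B v := by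
  simp [app]

theorem sub_app (A B : Matrix (Fin m) (Fin n) ℝ) (v : Vec n) :
    app (A - B) v = app A v - app B v := by
  simp [app]

theorem smul_app (a : ℝ) (A : Matrix (Fin m) (Fin n) ℝ) (v : Vec n) :
    app (a • A) v = a • app A v := by
  simp [app]

theorem sum_app {α : Type*} (s : Finset α) (A : α → Matrix (Fin m) (Fin n) ℝ) (v : Vec n) :
    app (∑ i ∈ s, A i) v = ∑ i ∈ s, app (A i) v := by
  simp [app]

theorem mul_app (A : Matrix (Fin l) (Fin m) ℝ) (B : Matrix (Fin m) (Fin n) ℝ) (v : Vec n) :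
    app (A * B) v = app A (app B v) := by
  ext i
  simp [app, Matrix.toLpLin_apply, Matrix.mulVec_mulVec]

theorem one_app (v : Vec n) : app (1 : Matrix (Fin n) (Fin n) ℝ) v = v := by
  ext i
  simp [app]

theorem norm_app_le (A : Matrix (Fin m) (Fin n) ℝ) (v : Vec n) : ‖app A v‖ ≤ ‖A‖ * ‖v‖ :=
  A.l2_opNorm_mulVec v

theorem norm_le_of_forall_app {A : Matrix (Fin m) (Fin n) ℝ} {a : ℝ} (ha : 0 ≤ a)
    (h : ∀ v, ‖app A v‖ ≤ a * ‖v‖) : ‖A‖ ≤ a := by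
  rw [Matrix.l2_opNorm_def]
  exact ContinuousLinearMap.opNorm_le_bound _ ha h

theorem abs_entry_le (A : Matrix (Fin m) (Fin n) ℝ) (i : Fin m) (j : Fin n) :
    |A i j| ≤ ‖A‖ := by
  have h := norm_app_le A (EuclideanSpace.single j 1)
  rw [PiLp.norm_single, norm_one, mul_one] at h
  have hi := (PiLp.norm_apply_le (app A (EuclideanSpace.single j 1)) i).trans h
  simpa [app, Matrix.toLpLin_apply] using hi

theorem norm_le_frobenius (A : Matrix (Fin m) (Fin n) ℝ) :
    ‖A‖ ≤ √(∑ i, ∑ j, A i j ^ 2) := by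
  refine norm_le_of_forall_app (Real.sqrt_nonneg _) fun v => ?_
  refine le_of_sq_le_sq ?_ (by positivity)
  rw [mul_pow, Real.sq_sqrt (by positivity), EuclideanSpace.norm_sq_eq, EuclideanSpace.norm_sq_eq,
    Finset.sum_mul]
  refine Finset.sum_le_sum fun i _ => ?_
  simp only [Real.norm_eq_abs, sq_abs]
  exact Finset.sum_mul_sq_le_sq_mul_sq Finset.univ (fun j => A i j) fun j => v j

theorem norm_pair_le (v : Vec m) (v' : Vec n) : ‖pair v v'‖ ≤ ‖v‖ + ‖v'‖ := by
  refine le_of_sq_le_sq ?_ (by positivity)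
  rw [pair, WithLp.prod_norm_sq_eq_of_L2]
  show ‖v‖ ^ 2 + ‖v'‖ ^ 2 ≤ _
  nlinarith [norm_nonneg v, norm_nonneg v', mul_nonneg (norm_nonneg v) (norm_nonneg v')]

theorem pair_sub (v₁ v₂ : Vec m) (v₁' v₂' : Vec n) :
    pair v₁ v₁' - pair v₂ v₂' = pair (v₁ - v₂) (v₁' - v₂') := rfl

end Matrices

/-! ### Geometric sums -/

section Geometric

variable {γ : ℝ}

theorem sum_geometric_le (hγ₀ : 0 < γ) (hγ₁ : γ ≤ 1) (n : ℕ) :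
    ∑ j ∈ Finset.range n, (1 - γ) ^ j ≤ 1 / γ := by
  have h : γ * ∑ j ∈ Finset.range n, (1 - γ) ^ j = 1 - (1 - γ) ^ n := by
    induction n with
    | zero => simp
    | succ n ih => rw [Finset.sum_range_succ, mul_add, ih]; ring
  rw [le_div_iff₀ hγ₀, mul_comm, h]
  linarith [pow_nonneg (sub_nonneg.2 hγ₁) n]

theorem sum_mul_geometric_le (hγ₀ : 0 < γ) (hγ₁ : γ ≤ 1) (n : ℕ) :
    ∑ j ∈ Finset.range n, (1 - γ) ^ j * (j + 1) ≤ 1 / γ ^ 2 := by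
  have h : γ ^ 2 * ∑ j ∈ Finset.range n, (1 - γ) ^ j * (j + 1) = 1 - (1 - γ) ^ n * (1 + n * γ) := by
    induction n with
    | zero => simp
    | succ n ih => rw [Finset.sum_range_succ, mul_add, ih]; push_cast; ring
  rw [le_div_iff₀ (by positivity), mul_comm, h]
  have := pow_nonneg (sub_nonneg.2 hγ₁) n
  have : 0 ≤ (1 - γ) ^ n * (1 + n * γ) := by positivity
  linarith

theorem norm_sum_geometric_le {E : Type*} [NormedAddCommGroup E] (hγ₀ : 0 < γ) (hγ₁ : γ ≤ 1)
    {a : ℝ} (ha : 0 ≤ a) {n : ℕ} {F : ℕ → E} (hF : ∀ j < n, ‖F j‖ ≤ a * (1 - γ) ^ j) :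
    ‖∑ j ∈ Finset.range n, F j‖ ≤ a / γ := by
  refine (norm_sum_le_of_le _ fun j hj => hF j (Finset.mem_range.1 hj)).trans ?_
  rw [← Finset.mul_sum, div_eq_mul_one_div]
  exact mul_le_mul_of_nonneg_left (sum_geometric_le hγ₀ hγ₁ n) ha

/-- Only the terms from index `N` on survive. The guard `j < n` also covers early rounds, where the
truncation window is longer than the history. -/
theorem norm_sum_sub_truncated_le {E : Type*} [NormedAddCommGroup E] (hγ₀ : 0 < γ) (hγ₁ : γ ≤ 1)
    {a : ℝ} (ha : 0 ≤ a) {n N : ℕ} {F : ℕ → E} (hF : ∀ j < n, ‖F j‖ ≤ a * (1 - γ) ^ j) :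
    ‖∑ j ∈ Finset.range n, F j - ∑ j ∈ Finset.range N, (if j < n then F j else 0)‖ ≤
      a * (1 - γ) ^ N / γ := by
  have h1 : ∑ j ∈ Finset.range n, F j = ∑ j ∈ Finset.range (N + n), if j < n then F j else 0 := by
    rw [← Finset.sum_filter]
    refine Finset.sum_congr ?_ fun _ _ => rfl
    ext j; simp; omega
  have hr := sub_nonneg.2 hγ₁
  rw [h1, Finset.sum_range_add, add_sub_cancel_left]
  refine norm_sum_geometric_le hγ₀ hγ₁ (by positivity) fun j _ => ?_
  split_ifs with h
  · refine (hF _ h).trans_eq ?_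
    rw [pow_add, mul_assoc]
  · rw [norm_zero]; positivity

end Geometric

/-! ### Disturbance feedback controllers -/

section Controllers

variable {H d₁ d₂ : ℕ} {A : Matrix (Fin d₁) (Fin d₁) ℝ} {B : Matrix (Fin d₁) (Fin d₂) ℝ}
  {K : Matrix (Fin d₂) (Fin d₁) ℝ} {κ γ W : ℝ} {T : ℕ} {w : ℕ → Vec d₁}

theorem StronglyStable.norm_pow_le (hK : StronglyStable κ γ A B K) (j : ℕ) :
    ‖(A - B * K) ^ j‖ ≤ κ ^ 2 * (1 - γ) ^ j := by
  obtain ⟨hκ, -, hγ₁, -, L, Q, hQ, hA, hL, hQn, hQi⟩ := hK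
  have hdet : IsUnit Q.det := (Matrix.isUnit_iff_isUnit_det Q).1 hQ
  have hpow : (A - B * K) ^ j = Q * L ^ j * Q⁻¹ := by
    rw [hA]
    induction j with
    | zero => rw [pow_zero, pow_zero, mul_one, Matrix.mul_nonsing_inv Q hdet]
    | succ j ih =>
      rw [pow_succ, ih, pow_succ]
      simp only [Matrix.mul_assoc]
      rw [Matrix.nonsing_inv_mul_cancel_left Q _ hdet]
  have hprod : ‖Q‖ * ‖Q⁻¹‖ ≤ κ ^ 2 := by
    rw [sq]; exact mul_le_mul hQn hQi (norm_nonneg _) hκ.le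
  rw [hpow]
  -- Exponent zero is separate because the identity matrix has norm `0`, not `1`, when `d₁ = 0`.
  rcases Nat.eq_zero_or_pos j with rfl | hj
  · rw [pow_zero, pow_zero, mul_one, mul_one]
    exact (Matrix.l2_opNorm_mul _ _).trans hprod
  · have hLj : ‖L ^ j‖ ≤ (1 - γ) ^ j := (norm_pow_le' L hj).trans (by gcongr)
    calc ‖Q * L ^ j * Q⁻¹‖ ≤ ‖Q‖ * ‖L ^ j‖ * ‖Q⁻¹‖ :=
          (Matrix.l2_opNorm_mul _ _).trans
            (mul_le_mul_of_nonneg_right (Matrix.l2_opNorm_mul _ _) (norm_nonneg _))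
      _ = ‖Q‖ * ‖Q⁻¹‖ * ‖L ^ j‖ := by ring
      _ ≤ κ ^ 2 * (1 - γ) ^ j := mul_le_mul hprod hLj (norm_nonneg _) (by positivity)

theorem StronglyStable.norm_pow_app_le (hK : StronglyStable κ γ A B K) (j : ℕ) {v : Vec d₁}
    {a : ℝ} (hv : ‖v‖ ≤ a) : ‖app ((A - B * K) ^ j) v‖ ≤ κ ^ 2 * a * (1 - γ) ^ j := by
  have hr := sub_nonneg.2 hK.2.2.1
  calc _ ≤ κ ^ 2 * (1 - γ) ^ j * a := (norm_app_le _ _).trans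
        (mul_le_mul (hK.norm_pow_le j) hv (norm_nonneg _) (by positivity))
    _ = _ := by ring

theorem norm_app_le_of_le {m n : ℕ} {D : Matrix (Fin m) (Fin n) ℝ} {v : Vec n} {b a : ℝ}
    (hD : ‖D‖ ≤ b) (hv : ‖v‖ ≤ a) : ‖app D v‖ ≤ b * a :=
  (norm_app_le D v).trans (mul_le_mul hD hv (norm_nonneg _) ((norm_nonneg _).trans hD))

theorem norm_past_le (hW : 0 ≤ W) (hw : ∀ t ∈ Finset.Icc 1 T, ‖w t‖ ≤ W) {t k : ℕ}
    (ht : t ≤ T + 1) (hk : 1 ≤ k) : ‖past w t k‖ ≤ W := by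
  rw [past]
  split_ifs with h
  · exact hw _ (Finset.mem_Icc.2 ⟨by omega, by omega⟩)
  · simpa using hW

theorem past_congr {w' : ℕ → Vec d₁} (h : ∀ t ∈ Finset.Icc 1 T, w t = w' t) {t k : ℕ}
    (ht : t ≤ T + 1) (hk : 1 ≤ k) : past w t k = past w' t k := by
  rw [past, past]
  split_ifs with hkt
  · exact h _ (Finset.mem_Icc.2 ⟨by omega, by omega⟩)
  · rfl

theorem past_past (t j k : ℕ) : past w t (j + 1 + k) = past w (t - 1 - j) k := by
  rw [past, past]
  have h1 : (j + 1 + k < t) ↔ (k < t - 1 - j) := by omega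
  have h2 : t - (j + 1 + k) = t - 1 - j - k := by omega
  simp only [h1, h2]

theorem block_add (M N : Param H d₁ d₂) (k : ℕ) : block (M + N) k = block M k + block N k := by
  ext a b
  simp only [block, Matrix.of_apply, Matrix.add_apply]
  split_ifs <;> simp

theorem block_smul (a : ℝ) (M : Param H d₁ d₂) (k : ℕ) : block (a • M) k = a • block M k := by
  ext i j
  simp only [block, Matrix.of_apply, Matrix.smul_apply]
  split_ifs <;> simp

theorem convex_feasible : Convex ℝ (feasible H d₁ d₂ κ γ) := by
  intro M hM N hN a b ha hb hab k hk
  rw [block_add, block_smul, block_smul]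
  calc ‖a • block M k + b • block N k‖ ≤ a * ‖block M k‖ + b * ‖block N k‖ := by
        refine (norm_add_le _ _).trans ?_
        rw [norm_smul, norm_smul, Real.norm_of_nonneg ha, Real.norm_of_nonneg hb]
    _ ≤ a * (2 * κ ^ 3 * (1 - γ) ^ k) + b * (2 * κ ^ 3 * (1 - γ) ^ k) := by
        gcongr
        · exact hM k hk
        · exact hN k hk
    _ = 2 * κ ^ 3 * (1 - γ) ^ k := by rw [← add_mul, hab, one_mul]

theorem norm_sq_eq_sum_block (M : Param H d₁ d₂) :
    ‖M‖ ^ 2 = ∑ k ∈ Finset.range H, ∑ a, ∑ b, block M k a b ^ 2 := by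
  rw [EuclideanSpace.norm_sq_eq, Fintype.sum_prod_type, ← Fin.sum_univ_eq_sum_range
    (fun k => ∑ a, ∑ b, block M k a b ^ 2)]
  refine Finset.sum_congr rfl fun k _ => ?_
  rw [Fintype.sum_prod_type]
  simp [block]

/-- Cauchy–Schwarz over the `H` blocks, and spectral norm below Frobenius norm. The factor `√H` in
the Lipschitz and gradient bounds originates here. -/
theorem sum_norm_block_le (M : Param H d₁ d₂) :
    ∑ k ∈ Finset.range H, ‖block M k‖ ≤ √H * ‖M‖ := by
  have hcs := sq_sum_le_card_mul_sum_sq (s := Finset.range H) (f := fun k => ‖block M k‖)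
  rw [Finset.card_range] at hcs
  refine le_of_sq_le_sq (hcs.trans ?_) (by positivity)
  rw [mul_pow, Real.sq_sqrt (by positivity), norm_sq_eq_sum_block]
  gcongr with k hk
  rw [← Real.sq_sqrt (by positivity : 0 ≤ ∑ a, ∑ b, block M k a b ^ 2)]
  have := norm_le_frobenius (block M k)
  gcongr

theorem norm_sq_le_of_mem_feasible (hκ : 0 ≤ κ) (hγ₀ : 0 ≤ γ) (hγ₁ : γ ≤ 1) {M : Param H d₁ d₂}
    (hM : M ∈ feasible H d₁ d₂ κ γ) : ‖M‖ ^ 2 ≤ H * (d₂ * d₁ * (2 * κ ^ 3) ^ 2) := by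
  rw [norm_sq_eq_sum_block]
  have hb : ∀ k ∈ Finset.range H, ∀ a b, block M k a b ^ 2 ≤ (2 * κ ^ 3) ^ 2 := by
    intro k hk a b
    have h1 : (1 - γ) ^ k ≤ 1 := pow_le_one₀ (by linarith) (by linarith)
    have h2 : |block M k a b| ≤ 2 * κ ^ 3 :=
      (abs_entry_le _ a b).trans ((hM k (Finset.mem_range.1 hk)).trans
        (mul_le_of_le_one_right (by positivity) h1))
    rw [← sq_abs]
    gcongr
  calc _ ≤ ∑ k ∈ Finset.range H, ∑ _a : Fin d₂, ∑ _b : Fin d₁, (2 * κ ^ 3) ^ 2 :=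
        Finset.sum_le_sum fun k hk => Finset.sum_le_sum fun a _ => Finset.sum_le_sum fun b _ =>
          hb k hk a b
    _ = _ := by
        simp only [Finset.sum_const, Finset.card_range, Finset.card_univ, Fintype.card_fin,
          nsmul_eq_mul]
        ring

/-- The feedforward term as a linear function of the parameter. -/
noncomputable def feedforwardLin (H d₂ : ℕ) (w : ℕ → Vec d₁) (t : ℕ) :
    Param H d₁ d₂ →ₗ[ℝ] Vec d₂ where
  toFun M := feedforward M w t
  map_add' M N := by simp [feedforward, block_add, add_app, Finset.sum_add_distrib]
  map_smul' a M := by simp [feedforward, block_smul, smul_app, Finset.smul_sum]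

theorem feedforward_eq_sum_range (M : Param H d₁ d₂) (t : ℕ) :
    feedforward M w t = ∑ k ∈ Finset.range H, app (block M k) (past w t (k + 1)) := by
  rw [feedforward, Finset.range_eq_Ico, ← Finset.Ico_add_one_right_eq_Icc]
  exact (Finset.sum_Ico_add' (fun k => app (block M (k - 1)) (past w t k)) 0 H 1).symm

theorem feedforward_congr {w' : ℕ → Vec d₁} (h : ∀ t ∈ Finset.Icc 1 T, w t = w' t) {t : ℕ}
    (ht : t ≤ T + 1) (M : Param H d₁ d₂) : feedforward M w t = feedforward M w' t := by
  simp only [feedforward_eq_sum_range]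
  exact Finset.sum_congr rfl fun k _ => by rw [past_congr h ht (by omega)]

theorem norm_feedforward_le_sum (hW : 0 ≤ W) (hw : ∀ t ∈ Finset.Icc 1 T, ‖w t‖ ≤ W) {t : ℕ}
    (ht : t ≤ T + 1) (M : Param H d₁ d₂) :
    ‖feedforward M w t‖ ≤ (∑ k ∈ Finset.range H, ‖block M k‖) * W := by
  rw [feedforward_eq_sum_range, Finset.sum_mul]
  exact norm_sum_le_of_le _ fun k _ => norm_app_le_of_le le_rfl (norm_past_le hW hw ht (by omega))

theorem norm_feedforward_le (hW : 0 ≤ W) (hw : ∀ t ∈ Finset.Icc 1 T, ‖w t‖ ≤ W) {t : ℕ}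
    (ht : t ≤ T + 1) (M : Param H d₁ d₂) : ‖feedforward M w t‖ ≤ W * √H * ‖M‖ := by
  refine (norm_feedforward_le_sum hW hw ht M).trans ?_
  have := mul_le_mul_of_nonneg_right (sum_norm_block_le M) hW
  linarith

theorem norm_feedforward_sub_le (hW : 0 ≤ W) (hw : ∀ t ∈ Finset.Icc 1 T, ‖w t‖ ≤ W) {t : ℕ}
    (ht : t ≤ T + 1) (M N : Param H d₁ d₂) :
    ‖feedforward M w t - feedforward N w t‖ ≤ W * √H * ‖M - N‖ := by
  have h : feedforward M w t - feedforward N w t = feedforward (M - N) w t :=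
    (map_sub (feedforwardLin H d₂ w t) M N).symm
  rw [h]
  exact norm_feedforward_le hW hw ht _

theorem norm_feedforward_le_of_mem_feasible (hW : 0 ≤ W)
    (hw : ∀ t ∈ Finset.Icc 1 T, ‖w t‖ ≤ W) (hκ : 0 ≤ κ) (hγ₀ : 0 < γ) (hγ₁ : γ ≤ 1) {t : ℕ}
    (ht : t ≤ T + 1) {M : Param H d₁ d₂} (hM : M ∈ feasible H d₁ d₂ κ γ) :
    ‖feedforward M w t‖ ≤ 2 * κ ^ 3 * W / γ := by
  refine (norm_feedforward_le_sum hW hw ht M).trans ?_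
  have h : ∑ k ∈ Finset.range H, ‖block M k‖ ≤ 2 * κ ^ 3 * (1 / γ) := by
    refine (Finset.sum_le_sum fun k hk => hM k (Finset.mem_range.1 hk)).trans ?_
    rw [← Finset.mul_sum]
    exact mul_le_mul_of_nonneg_left (sum_geometric_le hγ₀ hγ₁ H) (by positivity)
  refine (mul_le_mul_of_nonneg_right h hW).trans_eq ?_
  ring

theorem feedforward_zero (M : Param H d₁ d₂) : feedforward M w 0 = 0 := by
  simp [feedforward, past]

/-- Regrouping the transfer matrices by the power `j` of `A - B K` exhibits the surrogate as a
truncated unrolled recursion. The truncated subtraction `t - 1 - j` is harmless: feedforward at time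
`0` vanishes. -/
theorem surrogateState_eq (t : ℕ) (M : Param H d₁ d₂) :
    surrogateState A B K w t M = ∑ j ∈ Finset.range (H + 1),
      app ((A - B * K) ^ j) (past w t (j + 1) + app B (feedforward M w (t - 1 - j))) := by
  simp only [surrogateState, transfer, add_app, sum_app, app_add, Finset.sum_add_distrib]
  congr 1
  · have h : ∀ i, app (if i ≤ H then (A - B * K) ^ i else 0) (past w t (i + 1)) =
        if i < H + 1 then app ((A - B * K) ^ i) (past w t (i + 1)) else 0 := by
      intro i
      simp only [Nat.lt_succ_iff]
      split_ifs
      · rfl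
      · exact zero_app _
    simp only [h]
    rw [← Finset.sum_filter]
    refine Finset.sum_congr ?_ fun _ _ => rfl
    ext i; simp; omega
  · rw [Finset.sum_comm]
    refine Finset.sum_congr rfl fun j hj => ?_
    have hj' := Finset.mem_range.1 hj
    have h : ∀ i, app (if j + 1 ≤ i ∧ i ≤ j + H then
        (A - B * K) ^ j * B * block M (i - j - 1) else 0) (past w t (i + 1)) =
        if j + 1 ≤ i ∧ i ≤ j + H then app ((A - B * K) ^ j)
          (app B (app (block M (i - j - 1)) (past w t (i + 1)))) else 0 := by
      intro i
      split_ifs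
      · rw [mul_app, mul_app]
      · exact zero_app _
    simp only [h]
    rw [← Finset.sum_filter, feedforward_eq_sum_range, app_sum, app_sum]
    symm
    -- Block `k`, used by the control `j + 1` rounds ago, meets the noise at index `i = j + 1 + k`.
    refine Finset.sum_nbij' (fun k => j + 1 + k) (fun i => i - j - 1) ?_ ?_ ?_ ?_ ?_
    · intro k hk; simp at hk ⊢; omega
    · intro i hi; simp at hi ⊢; omega
    · intro k _; show j + 1 + k - j - 1 = k; omega
    · intro i hi; simp at hi ⊢; omega
    · intro k hk
      rw [← past_past]
      have h1 : j + 1 + k - j - 1 = k := by omega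
      rw [h1, add_assoc (j + 1) k 1]

theorem surrogateState_congr {w' : ℕ → Vec d₁} (h : ∀ t ∈ Finset.Icc 1 T, w t = w' t) {t : ℕ}
    (ht : t ≤ T + 1) (M : Param H d₁ d₂) :
    surrogateState A B K w t M = surrogateState A B K w' t M := by
  simp only [surrogateState]
  exact Finset.sum_congr rfl fun k _ => by rw [past_congr h ht (by omega)]

theorem surrogateAction_congr {w' : ℕ → Vec d₁} (h : ∀ t ∈ Finset.Icc 1 T, w t = w' t) {t : ℕ}
    (ht : t ≤ T + 1) (M : Param H d₁ d₂) :
    surrogateAction A B K w t M = surrogateAction A B K w' t M := by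
  rw [surrogateAction, surrogateAction, surrogateState_congr h ht, feedforward_congr h ht]

theorem surrogateState_succ (n : ℕ) (M : Param H d₁ d₂) :
    surrogateState A B K w (n + 1) M = ∑ j ∈ Finset.range (H + 1),
      if j < n then app ((A - B * K) ^ j) (w (n - j) + app B (feedforward M w (n - j))) else 0 := by
  rw [surrogateState_eq]
  refine Finset.sum_congr rfl fun j _ => ?_
  rw [Nat.add_sub_cancel, past]
  split_ifs with h1 h2 h2
  · rw [Nat.add_sub_add_right]
  · omega
  · omega
  · rw [Nat.sub_eq_zero_of_le (by omega), feedforward_zero, app_zero, add_zero, app_zero]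

/-- Solution of a linear recursion from the zero state. -/
theorem state_eq_sum {D : Matrix (Fin d₁) (Fin d₁) ℝ} {x v : ℕ → Vec d₁} (h1 : x 1 = 0)
    (hx : ∀ t ∈ Finset.Icc 1 T, x (t + 1) = app D (x t) + v t) {n : ℕ} (hn : n ≤ T) :
    x (n + 1) = ∑ j ∈ Finset.range n, app (D ^ j) (v (n - j)) := by
  induction n with
  | zero => simpa using h1
  | succ n ih =>
    rw [hx (n + 1) (Finset.mem_Icc.2 ⟨by omega, hn⟩), ih (by omega), Finset.sum_range_succ', app_sum]
    congr 1
    · refine Finset.sum_congr rfl fun j _ => ?_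
      rw [pow_succ', mul_app, Nat.add_sub_add_right]
    · simp [one_app]

theorem StronglyStable.norm_state_le (hK : StronglyStable κ γ A B K) {x v : ℕ → Vec d₁} {V : ℝ}
    (hV : 0 ≤ V) (h1 : x 1 = 0)
    (hx : ∀ t ∈ Finset.Icc 1 T, x (t + 1) = app (A - B * K) (x t) + v t)
    (hv : ∀ t ∈ Finset.Icc 1 T, ‖v t‖ ≤ V) {t : ℕ} (ht1 : 1 ≤ t) (ht : t ≤ T + 1) :
    ‖x t‖ ≤ κ ^ 2 * V / γ := by
  obtain ⟨n, rfl⟩ : ∃ n, t = n + 1 := ⟨t - 1, by omega⟩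
  rw [state_eq_sum h1 hx (by omega)]
  refine norm_sum_geometric_le hK.2.1 hK.2.2.1 (by positivity) fun j hj => ?_
  exact hK.norm_pow_app_le j (hv _ (Finset.mem_Icc.2 ⟨by omega, by omega⟩))

theorem StronglyStable.norm_surrogateState_le (hK : StronglyStable κ γ A B K) (hB : ‖B‖ ≤ κ)
    (hW : 0 ≤ W) (hw : ∀ t ∈ Finset.Icc 1 T, ‖w t‖ ≤ W) {M : Param H d₁ d₂} {Z : ℝ} (hZ : 0 ≤ Z)
    (hM : ∀ t ≤ T + 1, ‖feedforward M w t‖ ≤ Z) {t : ℕ} (ht : t ≤ T + 1) :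
    ‖surrogateState A B K w t M‖ ≤ κ ^ 2 * (W + κ * Z) / γ := by
  have hκ := hK.1
  rw [surrogateState_eq]
  refine norm_sum_geometric_le hK.2.1 hK.2.2.1 (by positivity) fun j _ => ?_
  exact hK.norm_pow_app_le j (norm_add_le_of_le (norm_past_le hW hw ht (by omega))
    (norm_app_le_of_le hB (hM _ (by omega))))

/-- Unrolling the state separates the input errors from the truncation to `H + 1` terms. An error `a
+ b (t - s)` at time `s`, damped geometrically, sums to `a / γ + b / γ ^ 2`. The run uses `a = 0`
(parameter drift), the linear comparator `b = 0` (imitation error). -/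
theorem StronglyStable.norm_state_sub_surrogateState_le (hK : StronglyStable κ γ A B K)
    (hB : ‖B‖ ≤ κ) (hW : 0 ≤ W) (hw : ∀ t ∈ Finset.Icc 1 T, ‖w t‖ ≤ W) {M : Param H d₁ d₂}
    {Z : ℝ} (hZ : 0 ≤ Z) (hM : ∀ t ≤ T + 1, ‖feedforward M w t‖ ≤ Z) {x : ℕ → Vec d₁}
    {z : ℕ → Vec d₂} (h1 : x 1 = 0)
    (hx : ∀ t ∈ Finset.Icc 1 T, x (t + 1) = app (A - B * K) (x t) + (w t + app B (z t)))
    {t : ℕ} (ht1 : 1 ≤ t) (ht : t ≤ T + 1) {a b : ℝ} (ha : 0 ≤ a) (hb : 0 ≤ b)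
    (hz : ∀ s, 1 ≤ s → s < t → ‖z s - feedforward M w s‖ ≤ a + b * (t - s : ℝ)) :
    ‖x t - surrogateState A B K w t M‖ ≤
      κ ^ 3 * (a / γ + b / γ ^ 2) + κ ^ 2 * (W + κ * Z) * (1 - γ) ^ (H + 1) / γ := by
  obtain ⟨hκ, hγ₀, hγ₁, -⟩ := id hK
  have hr := sub_nonneg.2 hγ₁
  obtain ⟨n, rfl⟩ : ∃ n, t = n + 1 := ⟨t - 1, by omega⟩
  rw [state_eq_sum h1 hx (by omega), surrogateState_succ]
  set F : ℕ → Vec d₁ := fun j =>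
    app ((A - B * K) ^ j) (w (n - j) + app B (feedforward M w (n - j))) with hF
  have hsplit : ∑ j ∈ Finset.range n, app ((A - B * K) ^ j) (w (n - j) + app B (z (n - j))) =
      ∑ j ∈ Finset.range n, app ((A - B * K) ^ j)
        (app B (z (n - j) - feedforward M w (n - j))) + ∑ j ∈ Finset.range n, F j := by
    rw [← Finset.sum_add_distrib]
    refine Finset.sum_congr rfl fun j _ => ?_
    rw [hF]
    simp only [app_add, app_sub]
    abel
  rw [hsplit, add_sub_assoc]
  refine norm_add_le_of_le ?_ ?_
  · have hterm : ∀ j ∈ Finset.range n, ‖app ((A - B * K) ^ j)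
        (app B (z (n - j) - feedforward M w (n - j)))‖ ≤
        κ ^ 3 * (a * (1 - γ) ^ j + b * ((1 - γ) ^ j * (j + 1))) := by
      intro j hj
      have hj' := Finset.mem_range.1 hj
      have h := hz (n - j) (by omega) (by omega)
      have hcast : ((n + 1 : ℕ) : ℝ) - ((n - j : ℕ) : ℝ) = j + 1 := by
        rw [Nat.cast_sub hj'.le]; push_cast; ring
      rw [hcast] at h
      refine (hK.norm_pow_app_le j (norm_app_le_of_le hB h)).trans_eq ?_
      ring
    refine (norm_sum_le_of_le _ hterm).trans ?_
    rw [← Finset.mul_sum, Finset.sum_add_distrib, ← Finset.mul_sum, ← Finset.mul_sum]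
    have h0 := mul_le_mul_of_nonneg_left (sum_geometric_le hγ₀ hγ₁ n) ha
    have h1 := mul_le_mul_of_nonneg_left (sum_mul_geometric_le hγ₀ hγ₁ n) hb
    rw [mul_one_div] at h0 h1
    gcongr
  · refine norm_sum_sub_truncated_le hγ₀ hγ₁ (by positivity) fun j hj => ?_
    exact hK.norm_pow_app_le j (norm_add_le_of_le (hw _ (Finset.mem_Icc.2 ⟨by omega, by omega⟩))
      (norm_app_le_of_le hB (hM _ (by omega))))

end Controllers

/-! ### Linear policies -/

section LinearPolicies

variable {m H d₁ d₂ : ℕ} {A : Matrix (Fin d₁) (Fin d₁) ℝ} {B : Matrix (Fin d₁) (Fin d₂) ℝ}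
  {K K' : Matrix (Fin d₂) (Fin d₁) ℝ} {κ γ W : ℝ} {T : ℕ} {w : ℕ → Vec d₁}

theorem linearState_succ {t : ℕ} (ht : 1 ≤ t) :
    linearState A B w K (t + 1) = app (A - B * K) (linearState A B w K t) + w t := by
  obtain ⟨s, rfl⟩ : ∃ s, t = s + 1 := ⟨t - 1, by omega⟩
  rw [linearState, sub_app, mul_app, app_neg, ← sub_eq_add_neg]

theorem linearState_succ_eq (K : Matrix (Fin d₂) (Fin d₁) ℝ) {t : ℕ} (ht : 1 ≤ t) :
    linearState A B w K' (t + 1) = app (A - B * K) (linearState A B w K' t) +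
      (w t + app B (app (K - K') (linearState A B w K' t))) := by
  rw [linearState_succ ht]
  simp only [sub_app, mul_app, app_sub]
  abel

/-- The disturbance feedback parameter that imitates the linear policy `K'` on top of `K`. -/
noncomputable def imitation (H : ℕ) (A : Matrix (Fin d₁) (Fin d₁) ℝ)
    (B : Matrix (Fin d₁) (Fin d₂) ℝ) (K K' : Matrix (Fin d₂) (Fin d₁) ℝ) : Param H d₁ d₂ :=
  WithLp.toLp 2 fun q => ((K - K') * (A - B * K') ^ (q.1 : ℕ)) q.2.1 q.2.2

theorem block_imitation {k : ℕ} (hk : k < H) :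
    block (imitation H A B K K') k = (K - K') * (A - B * K') ^ k := by
  ext a b
  simp [block, imitation, hk]

theorem StronglyStable.norm_sub_le (hK : StronglyStable κ γ A B K)
    (hK' : StronglyStable κ γ A B K') : ‖K - K'‖ ≤ 2 * κ := by
  have h := _root_.norm_sub_le K K'
  linarith [hK.2.2.2.1, hK'.2.2.2.1]

/-- The radius `2 κ ^ 3` of the feasible set is `2 κ` for `K - K'` times `κ ^ 2` for the powers of
`A - B K'`. -/
theorem StronglyStable.imitation_mem_feasible (hK : StronglyStable κ γ A B K)
    (hK' : StronglyStable κ γ A B K') : imitation H A B K K' ∈ feasible H d₁ d₂ κ γ := by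
  intro k hk
  have hκ := hK.1
  rw [block_imitation hk]
  calc _ ≤ (2 * κ) * (κ ^ 2 * (1 - γ) ^ k) := (Matrix.l2_opNorm_mul _ _).trans
        (mul_le_mul (hK.norm_sub_le hK') (hK'.norm_pow_le k) (norm_nonneg _) (by positivity))
    _ = _ := by ring

/-- Unrolled under `K'`, the control `(K - K') x` is a sum over all past noises, and the imitation
keeps exactly the latest `H` terms. -/
theorem StronglyStable.norm_sub_feedforward_imitation_le (hK : StronglyStable κ γ A B K)
    (hK' : StronglyStable κ γ A B K') (hW : 0 ≤ W) (hw : ∀ t ∈ Finset.Icc 1 T, ‖w t‖ ≤ W)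
    {t : ℕ} (ht1 : 1 ≤ t) (ht : t ≤ T + 1) :
    ‖app (K - K') (linearState A B w K' t) - feedforward (imitation H A B K K') w t‖ ≤
      2 * κ ^ 3 * W * (1 - γ) ^ H / γ := by
  have hκ := hK.1
  obtain ⟨n, rfl⟩ : ∃ n, t = n + 1 := ⟨t - 1, by omega⟩
  rw [state_eq_sum (T := T) (by simp [linearState])
    (fun _ hs => linearState_succ (Finset.mem_Icc.1 hs).1) (by omega), app_sum,
    feedforward_eq_sum_range]
  have hff : ∑ k ∈ Finset.range H, app (block (imitation H A B K K') k) (past w (n + 1) (k + 1)) =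
      ∑ k ∈ Finset.range H, if k < n then app (K - K') (app ((A - B * K') ^ k) (w (n - k)))
        else 0 := by
    refine Finset.sum_congr rfl fun k hk => ?_
    rw [block_imitation (Finset.mem_range.1 hk), mul_app, past]
    simp only [Nat.add_lt_add_iff_right, Nat.add_sub_add_right]
    split_ifs <;> simp
  rw [hff]
  refine norm_sum_sub_truncated_le hK.2.1 hK.2.2.1 (by positivity) fun j hj => ?_
  refine (norm_app_le_of_le (hK.norm_sub_le hK') (hK'.norm_pow_app_le j
    (hw (n - j) (Finset.mem_Icc.2 ⟨by omega, by omega⟩)))).trans_eq ?_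
  ring

theorem continuous_app {n k : ℕ} : Continuous fun q : Matrix (Fin n) (Fin k) ℝ × Vec k =>
    app q.1 q.2 := by
  refine (PiLp.continuous_toLp 2 _).comp ?_
  exact continuous_fst.matrix_mulVec ((PiLp.continuous_ofLp 2 _).comp continuous_snd)

theorem continuous_linearState (A : Matrix (Fin d₁) (Fin d₁) ℝ) (B : Matrix (Fin d₁) (Fin d₂) ℝ)
    (w : ℕ → Vec d₁) (t : ℕ) : Continuous fun K => linearState A B w K t := by
  rcases Nat.eq_zero_or_pos t with rfl | ht
  · exact continuous_const
  induction t, ht using Nat.le_induction with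
  | base => exact continuous_const
  | succ t ht ih =>
    simp only [linearState_succ ht]
    exact (continuous_app.comp
      ((continuous_const.sub (continuous_const.matrix_mul continuous_id)).prodMk ih)).add
      continuous_const

theorem IsCost.continuous {G : ℝ} {c : Pair d₁ d₂ → ℝ} (hc : IsCost G c) : Continuous c := by
  have h : ∀ {E : Type} [NormedAddCommGroup E] [NormedSpace ℝ E] {f : E → ℝ},
      Differentiable ℝ f → Continuous f := fun h => h.continuous
  exact h hc.differentiable

theorem continuous_linearCost {G : ℝ} {c : Fin m → ℕ → Pair d₁ d₂ → ℝ}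
    (hc : ∀ i, ∀ t ∈ Finset.Icc 1 T, IsCost G (c i t)) :
    Continuous fun K => linearCost A B w c T K := by
  unfold linearCost totalCost
  refine continuous_finsetSum _ fun t ht => ?_
  refine continuous_finsetSum _ fun i _ => ?_
  refine (hc i t ht).continuous.comp ?_
  have hx := continuous_linearState A B w t
  exact (WithLp.prod_continuous_toLp 2 _ _).comp
    (hx.prodMk (continuous_app.comp (continuous_id.prodMk hx)).neg)

/-- With the inverse of `Q` as an extra variable `R` and the equation `Q R = 1`, the certificates
`(K, L, Q, R)` form a closed bounded set, of which this is a projection. -/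
theorem isCompact_stronglyStable : IsCompact {K | StronglyStable κ γ A B K} := by
  by_cases hpar : 0 < κ ∧ 0 < γ ∧ γ ≤ 1
  · set C : Set (Matrix (Fin d₂) (Fin d₁) ℝ × Matrix (Fin d₁) (Fin d₁) ℝ ×
        Matrix (Fin d₁) (Fin d₁) ℝ × Matrix (Fin d₁) (Fin d₁) ℝ) :=
      (Metric.closedBall 0 κ ×ˢ Metric.closedBall 0 (1 - γ) ×ˢ Metric.closedBall 0 κ ×ˢ
        Metric.closedBall 0 κ) ∩
      ({q | q.2.2.1 * q.2.2.2 = 1} ∩ {q | A - B * q.1 = q.2.2.1 * q.2.1 * q.2.2.2}) with hC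
    have hcompact : IsCompact C := by
      refine IsCompact.inter_right ?_ (IsClosed.inter (isClosed_eq ?_ ?_) (isClosed_eq ?_ ?_))
      · exact (isCompact_closedBall _ _).prod ((isCompact_closedBall _ _).prod
          ((isCompact_closedBall _ _).prod (isCompact_closedBall _ _)))
      · exact (continuous_fst.comp (continuous_snd.comp continuous_snd)).matrix_mul
          (continuous_snd.comp (continuous_snd.comp continuous_snd))
      · exact continuous_const
      · exact continuous_const.sub (continuous_const.matrix_mul continuous_fst)
      · exact ((continuous_fst.comp (continuous_snd.comp continuous_snd)).matrix_mul
          (continuous_fst.comp continuous_snd)).matrix_mul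
          (continuous_snd.comp (continuous_snd.comp continuous_snd))
    have himage : {K | StronglyStable κ γ A B K} = Prod.fst '' C := by
      ext K
      constructor
      · rintro ⟨-, -, -, hK, L, Q, hQ, hA, hL, hQn, hQi⟩
        refine ⟨(K, L, Q, Q⁻¹), ⟨⟨by simpa using hK, by simpa using hL, by simpa using hQn,
          by simpa using hQi⟩, ?_, hA⟩, rfl⟩
        exact Matrix.mul_nonsing_inv Q ((Matrix.isUnit_iff_isUnit_det Q).1 hQ)
      · rintro ⟨⟨K, L, Q, R⟩, ⟨⟨hK, hL, hQn, hR⟩, hQR, hA⟩, rfl⟩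
        have hinv : Q⁻¹ = R := Matrix.inv_eq_right_inv hQR
        refine ⟨hpar.1, hpar.2.1, hpar.2.2, by simpa using hK, L, Q, ?_, ?_, by simpa using hL,
          by simpa using hQn, ?_⟩
        · exact (Matrix.isUnit_iff_isUnit_det Q).2 (Matrix.isUnit_det_of_right_inverse hQR)
        · rw [hinv]; exact hA
        · rw [hinv]; simpa using hR
    rw [himage]
    exact hcompact.image continuous_fst
  · convert isCompact_empty
    ext K
    simp only [Set.mem_ofPred_eq, Set.mem_empty_iff_false, iff_false]
    exact fun h => hpar ⟨h.1, h.2.1, h.2.2.1⟩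

theorem exists_isMinOn_linearCost {G : ℝ} {c : Fin m → ℕ → Pair d₁ d₂ → ℝ}
    (hc : ∀ i, ∀ t ∈ Finset.Icc 1 T, IsCost G (c i t)) (hK : StronglyStable κ γ A B K) :
    ∃ Kopt, StronglyStable κ γ A B Kopt ∧ ∀ K', StronglyStable κ γ A B K' →
      linearCost A B w c T Kopt ≤ linearCost A B w c T K' := by
  obtain ⟨Kopt, hmem, hmin⟩ := isCompact_stronglyStable.exists_isMinOn ⟨K, hK⟩
    (continuous_linearCost (A := A) (B := B) (w := w) hc).continuousOn
  exact ⟨Kopt, hmem, fun K' hK' => hmin hK'⟩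

end LinearPolicies

/-! ### Surrogate costs -/

section SurrogateCosts

variable {H d₁ d₂ : ℕ} {A : Matrix (Fin d₁) (Fin d₁) ℝ} {B : Matrix (Fin d₁) (Fin d₂) ℝ}
  {K : Matrix (Fin d₂) (Fin d₁) ℝ} {κ γ W G : ℝ} {T : ℕ} {w : ℕ → Vec d₁}

/-- By convexity a one-sided bound needs the gradient only at the first point, so the second point
may be arbitrary; no bound on the comparator's trajectory is required. -/
theorem IsCost.sub_le {c : Pair d₁ d₂ → ℝ} (hc : IsCost G c) {D : ℝ} {y : Vec d₁} {v : Vec d₂}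
    (hy : ‖y‖ ≤ D) (hv : ‖v‖ ≤ D) (q : Pair d₁ d₂) :
    c (pair y v) - c q ≤ G * D * ‖pair y v - q‖ := by
  refine (sub_le_fderiv_of_convexOn hc.convex (hc.differentiable _) q).trans ?_
  refine (Real.le_norm_self _).trans ((ContinuousLinearMap.le_opNorm _ _).trans ?_)
  rw [← toDual_gradient, LinearIsometryEquiv.norm_map]
  exact mul_le_mul_of_nonneg_right (hc.gradient_le D y v hy hv) (norm_nonneg _)

theorem sub_le_inner_gradient_comp {E F : Type*} [NormedAddCommGroup E] [InnerProductSpace ℝ E]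
    [CompleteSpace E] [NormedAddCommGroup F] [NormedSpace ℝ F] {c : F → ℝ}
    (hc : ConvexOn ℝ Set.univ c) (hd : Differentiable ℝ c) (p : F) (Λ : E →L[ℝ] F) (M N : E) :
    c (p + Λ M) - c (p + Λ N) ≤ inner ℝ (gradient (fun N => c (p + Λ N)) M) (M - N) := by
  have h : HasFDerivAt (fun N => c (p + Λ N)) ((fderiv ℝ c (p + Λ M)).comp Λ) M :=
    (hd (p + Λ M)).hasFDerivAt.comp M (Λ.hasFDerivAt.const_add p)
  rw [← InnerProductSpace.toDual_apply_apply (𝕜 := ℝ), toDual_gradient, h.fderiv]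
  refine (sub_le_fderiv_of_convexOn hc (hd _) _).trans_eq ?_
  simp

theorem norm_gradient_comp_le {E F : Type*} [NormedAddCommGroup E] [InnerProductSpace ℝ E]
    [CompleteSpace E] [NormedAddCommGroup F] [InnerProductSpace ℝ F] [CompleteSpace F] {c : F → ℝ}
    (hd : Differentiable ℝ c) (p : F) (Λ : E →L[ℝ] F) (M : E) :
    ‖gradient (fun N => c (p + Λ N)) M‖ ≤ ‖gradient c (p + Λ M)‖ * ‖Λ‖ := by
  have h : HasFDerivAt (fun N => c (p + Λ N)) ((fderiv ℝ c (p + Λ M)).comp Λ) M :=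
    (hd (p + Λ M)).hasFDerivAt.comp M (Λ.hasFDerivAt.const_add p)
  rw [← LinearIsometryEquiv.norm_map (InnerProductSpace.toDual ℝ E), toDual_gradient, h.fderiv,
    ← LinearIsometryEquiv.norm_map (InnerProductSpace.toDual ℝ F), toDual_gradient]
  exact ContinuousLinearMap.opNorm_comp_le _ _

/-- The linear part of the surrogate state. -/
noncomputable def stateLin (H : ℕ) (A : Matrix (Fin d₁) (Fin d₁) ℝ)
    (B : Matrix (Fin d₁) (Fin d₂) ℝ) (K : Matrix (Fin d₂) (Fin d₁) ℝ) (w : ℕ → Vec d₁) (t : ℕ) :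
    Param H d₁ d₂ →ₗ[ℝ] Vec d₁ :=
  ∑ j ∈ Finset.range (H + 1), Matrix.toEuclideanLin ((A - B * K) ^ j) ∘ₗ
    Matrix.toEuclideanLin B ∘ₗ feedforwardLin H d₂ w (t - 1 - j)

/-- The linear part of the surrogate state-action pair. -/
noncomputable def pairLin (H : ℕ) (A : Matrix (Fin d₁) (Fin d₁) ℝ)
    (B : Matrix (Fin d₁) (Fin d₂) ℝ) (K : Matrix (Fin d₂) (Fin d₁) ℝ) (w : ℕ → Vec d₁) (t : ℕ) :
    Param H d₁ d₂ →ₗ[ℝ] Pair d₁ d₂ :=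
  (WithLp.linearEquiv 2 ℝ (Vec d₁ × Vec d₂)).symm.toLinearMap ∘ₗ
    (stateLin H A B K w t).prod
      (-(Matrix.toEuclideanLin K ∘ₗ stateLin H A B K w t) + feedforwardLin H d₂ w t)

theorem stateLin_apply (t : ℕ) (M : Param H d₁ d₂) : stateLin H A B K w t M =
    ∑ j ∈ Finset.range (H + 1),
      app ((A - B * K) ^ j) (app B (feedforward M w (t - 1 - j))) := by
  simp only [stateLin, LinearMap.sum_apply]
  rfl

theorem surrogateState_eq_add (t : ℕ) (M : Param H d₁ d₂) :
    surrogateState A B K w t M = surrogateState A B K w t (0 : Param H d₁ d₂) +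
      stateLin H A B K w t M := by
  have h0 : ∀ s, feedforward (0 : Param H d₁ d₂) w s = 0 :=
    fun s => map_zero (feedforwardLin H d₂ w s)
  simp only [surrogateState_eq, stateLin_apply, h0, app_zero, add_zero, app_add,
    Finset.sum_add_distrib]

theorem surrogatePair_eq_add (t : ℕ) (M : Param H d₁ d₂) :
    pair (surrogateState A B K w t M) (surrogateAction A B K w t M) =
      pair (surrogateState A B K w t (0 : Param H d₁ d₂))
        (surrogateAction A B K w t (0 : Param H d₁ d₂)) + pairLin H A B K w t M := by
  have h0 : feedforward (0 : Param H d₁ d₂) w t = 0 := map_zero (feedforwardLin H d₂ w t)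
  have hp : pairLin H A B K w t M = pair (stateLin H A B K w t M)
    (-app K (stateLin H A B K w t M) + feedforward M w t) := rfl
  have hadd : ∀ (y y' : Vec d₁) (v v' : Vec d₂), pair y v + pair y' v' = pair (y + y') (v + v') :=
    fun _ _ _ _ => rfl
  rw [hp, hadd, surrogateAction, surrogateAction, h0, surrogateState_eq_add t M, app_add]
  congr 1
  abel

theorem StronglyStable.exists_surrogatePair_eq_add (hK : StronglyStable κ γ A B K) (hB : ‖B‖ ≤ κ) (hW : 0 ≤ W)
    (hw : ∀ t ∈ Finset.Icc 1 T, ‖w t‖ ≤ W) {t : ℕ} (ht : t ≤ T + 1) :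
    ∃ Λ : Param H d₁ d₂ →L[ℝ] Pair d₁ d₂, ‖Λ‖ ≤ (κ ^ 3 / γ + κ ^ 4 / γ + 1) * W * √H ∧
      ∀ M, pair (surrogateState A B K w t M) (surrogateAction A B K w t M) =
        pair (surrogateState A B K w t (0 : Param H d₁ d₂))
          (surrogateAction A B K w t (0 : Param H d₁ d₂)) + Λ M := by
  obtain ⟨hκ, hγ₀, hγ₁, hKκ, -⟩ := id hK
  refine ⟨(pairLin H A B K w t).mkContinuous _ fun M => ?_,
    LinearMap.mkContinuous_norm_le _ (by positivity) _, surrogatePair_eq_add t⟩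
  have hs : ‖stateLin H A B K w t M‖ ≤ κ ^ 2 * (κ * (W * √H * ‖M‖)) / γ := by
    rw [stateLin_apply]
    refine norm_sum_geometric_le hγ₀ hγ₁ (by positivity) fun j _ => ?_
    exact hK.norm_pow_app_le j (norm_app_le_of_le hB (norm_feedforward_le hW hw (by omega) M))
  have ha := norm_app_le_of_le hKκ hs
  have hf := norm_feedforward_le hW hw ht M
  calc ‖(pairLin H A B K w t) M‖ = ‖pair (stateLin H A B K w t M)
        (-app K (stateLin H A B K w t M) + feedforward M w t)‖ := rfl
    _ ≤ κ ^ 2 * (κ * (W * √H * ‖M‖)) / γ +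
        (κ * (κ ^ 2 * (κ * (W * √H * ‖M‖)) / γ) + W * √H * ‖M‖) := by
        refine (norm_pair_le _ _).trans (add_le_add hs (norm_add_le_of_le ?_ hf))
        rwa [norm_neg]
    _ = _ := by ring

theorem IsCost.surrogateCost_sub_le {c : Pair d₁ d₂ → ℝ} (hc : IsCost G c)
    (hK : StronglyStable κ γ A B K) (hB : ‖B‖ ≤ κ) (hW : 0 ≤ W)
    (hw : ∀ t ∈ Finset.Icc 1 T, ‖w t‖ ≤ W) {t : ℕ} (ht : t ≤ T + 1) (M N : Param H d₁ d₂) :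
    surrogateCost A B K w c t M - surrogateCost A B K w c t N ≤
      inner ℝ (gradient (surrogateCost A B K w c t) M) (M - N) := by
  obtain ⟨Λ, -, hΛ⟩ := hK.exists_surrogatePair_eq_add (H := H) hB hW hw ht
  have heq : surrogateCost A B K w c t = fun M : Param H d₁ d₂ => c (pair
      (surrogateState A B K w t (0 : Param H d₁ d₂))
        (surrogateAction A B K w t (0 : Param H d₁ d₂)) + Λ M) := by
    funext M
    rw [surrogateCost, hΛ]
  rw [heq]
  exact sub_le_inner_gradient_comp hc.convex hc.differentiable _ Λ M N

theorem IsCost.norm_gradient_surrogateCost_le {c : Pair d₁ d₂ → ℝ} (hc : IsCost G c)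
    (hK : StronglyStable κ γ A B K) (hB : ‖B‖ ≤ κ) (hW : 0 ≤ W)
    (hw : ∀ t ∈ Finset.Icc 1 T, ‖w t‖ ≤ W) {t : ℕ} (ht : t ≤ T + 1) {D : ℝ} {M : Param H d₁ d₂}
    (hy : ‖surrogateState A B K w t M‖ ≤ D) (hv : ‖surrogateAction A B K w t M‖ ≤ D) :
    ‖gradient (surrogateCost A B K w c t) M‖ ≤
      G * D * ((κ ^ 3 / γ + κ ^ 4 / γ + 1) * W * √H) := by
  obtain ⟨Λ, hΛn, hΛ⟩ := hK.exists_surrogatePair_eq_add (H := H) hB hW hw ht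
  have heq : surrogateCost A B K w c t = fun M : Param H d₁ d₂ => c (pair
      (surrogateState A B K w t (0 : Param H d₁ d₂))
        (surrogateAction A B K w t (0 : Param H d₁ d₂)) + Λ M) := by
    funext M
    rw [surrogateCost, hΛ]
  have hgrad := hc.gradient_le D _ _ hy hv
  rw [hΛ] at hgrad
  rw [heq]
  exact (norm_gradient_comp_le hc.differentiable _ Λ M).trans
    (mul_le_mul hgrad hΛn (norm_nonneg _) ((norm_nonneg _).trans hgrad))

end SurrogateCosts

/-! ### Regret of the distributed controller -/

section Run

variable {m H d₁ d₂ : ℕ} {A : Matrix (Fin d₁) (Fin d₁) ℝ} {B : Matrix (Fin d₁) (Fin d₂) ℝ}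
  {K K' : Matrix (Fin d₂) (Fin d₁) ℝ} {P : Matrix (Fin m) (Fin m) ℝ} {κ γ W G η : ℝ} {T : ℕ}
  {w : ℕ → Vec d₁} {c : Fin m → ℕ → Pair d₁ d₂ → ℝ} {x : Fin m → ℕ → Vec d₁}
  {u : Fin m → ℕ → Vec d₂} {what : Fin m → ℕ → Vec d₁} {M : Fin m → ℕ → Param H d₁ d₂}

theorem norm_sub_le_of_norm_step_le {E : Type*} [NormedAddCommGroup E] {z : ℕ → E} {Δ : ℝ}
    (h : ∀ t ∈ Finset.Icc 1 T, ‖z (t + 1) - z t‖ ≤ Δ) {s t : ℕ} (hs : 1 ≤ s) (hst : s ≤ t)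
    (ht : t ≤ T + 1) : ‖z s - z t‖ ≤ Δ * (t - s : ℝ) := by
  induction t, hst using Nat.le_induction with
  | base => simp
  | succ t hst ih =>
    have h1 := h t (Finset.mem_Icc.2 ⟨hs.trans hst, by omega⟩)
    have h2 : z s - z (t + 1) = (z s - z t) - (z (t + 1) - z t) := by abel
    rw [h2]
    refine (norm_sub_le_of_le (ih (by omega)) h1).trans_eq ?_
    push_cast; ring

theorem norm_pair_sub_surrogatePair_le (hK : ‖K‖ ≤ κ) {t : ℕ} {N : Param H d₁ d₂} {y : Vec d₁}
    {z : Vec d₂} {e a : ℝ} (hy : ‖y - surrogateState A B K w t N‖ ≤ e)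
    (hz : ‖z - feedforward N w t‖ ≤ a) :
    ‖pair y (-app K y + z) -
      pair (surrogateState A B K w t N) (surrogateAction A B K w t N)‖ ≤ (1 + κ) * e + a := by
  have hsplit : -app K y + z - surrogateAction A B K w t N =
      -app K (y - surrogateState A B K w t N) + (z - feedforward N w t) := by
    rw [surrogateAction, app_sub]; abel
  rw [pair_sub, hsplit]
  have h1 := norm_app_le_of_le hK hy
  have h2 := norm_add_le (-app K (y - surrogateState A B K w t N)) (z - feedforward N w t)
  rw [norm_neg] at h2
  linarith [norm_pair_le (y - surrogateState A B K w t N)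
    (-app K (y - surrogateState A B K w t N) + (z - feedforward N w t))]

theorem IsRun.recover_eq (h : IsRun κ γ η A B K P T w c x u what M) (i : Fin m) {t : ℕ}
    (ht : t ∈ Finset.Icc 1 T) : what i t = w t := by
  rw [h.recover i t ht, h.dynamics i t ht]; abel

theorem IsRun.control_eq (h : IsRun κ γ η A B K P T w c x u what M) (i : Fin m) {t : ℕ}
    (ht : t ∈ Finset.Icc 1 T) : u i t = -app K (x i t) + feedforward (M i t) w t := by
  rw [h.control i t ht, feedforward_congr (w := what i) (w' := w) (fun s hs => h.recover_eq i hs)]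
  exact (Finset.mem_Icc.1 ht).2.trans (Nat.le_succ T)

theorem IsRun.state_succ (h : IsRun κ γ η A B K P T w c x u what M) (i : Fin m) {t : ℕ}
    (ht : t ∈ Finset.Icc 1 T) :
    x i (t + 1) = app (A - B * K) (x i t) + (w t + app B (feedforward (M i t) w t)) := by
  rw [h.dynamics i t ht, h.control_eq i ht, sub_app, mul_app, app_add, app_neg]
  abel

theorem IsRun.surrogateCost_eq (h : IsRun κ γ η A B K P T w c x u what M) (i : Fin m) {t : ℕ}
    (ht : t ≤ T + 1) (f : Pair d₁ d₂ → ℝ) :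
    surrogateCost (H := H) A B K (what i) f t = surrogateCost A B K w f t := by
  funext N
  rw [surrogateCost, surrogateCost,
    surrogateState_congr (w := what i) (w' := w) (fun s hs => h.recover_eq i hs) ht,
    surrogateAction_congr (w := what i) (w' := w) (fun s hs => h.recover_eq i hs) ht]

/-- Bound on the feedforward controls of feasible parameters. -/
noncomputable def feedforwardBound (κ γ W : ℝ) : ℝ := 2 * κ ^ 3 * W / γ

/-- Bound on the states of feasible controllers. -/
noncomputable def stateBound (κ γ W : ℝ) : ℝ := κ ^ 2 * (W + κ * feedforwardBound κ γ W) / γ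

/-- Bound on the states and actions of feasible controllers. -/
noncomputable def radius (κ γ W : ℝ) : ℝ :=
  stateBound κ γ W + (κ * stateBound κ γ W + feedforwardBound κ γ W)

/-- Bound on the gradients of the surrogate costs, up to a factor `√H`. -/
noncomputable def gradientBound (κ γ W G : ℝ) : ℝ :=
  G * radius κ γ W * ((κ ^ 3 / γ + κ ^ 4 / γ + 1) * W)

/-- Coefficient of the learning rate in the regret bound. -/
noncomputable def rateCoeff (m : ℕ) (κ γ W G : ℝ) : ℝ :=
  G * radius κ γ W * ((1 + κ) * (κ ^ 3 * (W * (gradientBound κ γ W G * (1 + 4 * √m))) / γ ^ 2)) +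
    gradientBound κ γ W G ^ 2 * (8 * √m + 1)

/-- Coefficient of the truncation error in the regret bound. -/
noncomputable def truncationCoeff (κ γ W G : ℝ) : ℝ :=
  G * radius κ γ W * ((1 + κ) * (κ ^ 3 * (feedforwardBound κ γ W / γ) + 2 * stateBound κ γ W) +
    feedforwardBound κ γ W)

/-- Coefficient of the diameter of the feasible set in the regret bound. -/
noncomputable def diameterCoeff (d₁ d₂ : ℕ) (κ : ℝ) : ℝ := 2 * (d₂ * d₁ * (2 * κ ^ 3) ^ 2)

set_option maxHeartbeats 1000000 in
theorem IsRun.regret_le (h : IsRun κ γ η A B K P T w c x u what M) (hP : IsNetwork P)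
    (hB : ‖B‖ ≤ κ) (hW : 0 ≤ W) (hw : ∀ t ∈ Finset.Icc 1 T, ‖w t‖ ≤ W)
    (hc : ∀ i, ∀ t ∈ Finset.Icc 1 T, IsCost G (c i t)) (hG : 0 ≤ G)
    (hK : StronglyStable κ γ A B K) (hη : 0 < η) (hK' : StronglyStable κ γ A B K') (j : Fin m) :
    totalCost c T (x j) (u j) - linearCost A B w c T K' ≤
      m * (rateCoeff m κ γ W G * (T * (η * H)) / (1 - secondSingularValue P) +
        truncationCoeff κ γ W G * (T * (1 - γ) ^ H) + diameterCoeff d₁ d₂ κ * (H / η)) := by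
  obtain ⟨hκ, hγ₀, hγ₁, hKκ, -⟩ := id hK
  have hr := sub_nonneg.2 hγ₁
  set Z := feedforwardBound κ γ W with hZdef
  set X := stateBound κ γ W with hXdef
  set D := radius κ γ W
  set g₀ := gradientBound κ γ W G with hg₀def
  set ρ := (1 - γ) ^ H
  set b := (1 - secondSingularValue P)⁻¹ with hbdef
  have hZ0 : 0 ≤ Z := by rw [hZdef, feedforwardBound]; positivity
  have hX0 : 0 ≤ X := by rw [hXdef, stateBound]; positivity
  have hD : D = X + (κ * X + Z) := rfl
  have hD0 : 0 ≤ D := by rw [hD]; positivity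
  have hg₀0 : 0 ≤ g₀ := by rw [hg₀def, gradientBound]; positivity
  have hβ : 0 < 1 - secondSingularValue P := sub_pos.2 hP.secondSingularValue_lt_one
  have hb1 : 1 ≤ b := (one_le_inv₀ hβ).2 (by
    linarith [IsNetwork.secondSingularValue_nonneg (P := P)])
  have hρ0 : 0 ≤ ρ := by positivity
  have hρ1 : (1 - γ) ^ (H + 1) ≤ ρ := pow_le_pow_of_le_one hr (by linarith) (Nat.le_succ H)
  set g : Fin m → ℕ → Param H d₁ d₂ := fun i t =>
    gradient (surrogateCost A B K w (c i t) t) (M i t)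
  set gb := g₀ * √H with hgb
  have hgb0 : 0 ≤ gb := by positivity
  -- `R` bounds the disagreement: twice the deviation bound. The drift `Δ` of one round is a
  -- gradient step plus a mixing step.
  set R := 4 * √m * (η * gb) * b with hR
  set Δ := η * gb + R with hΔ
  set N := imitation H A B K K' with hN
  have hNmem : N ∈ feasible H d₁ d₂ κ γ := hK.imitation_mem_feasible hK'
  have hff : ∀ N ∈ feasible H d₁ d₂ κ γ, ∀ t ≤ T + 1, ‖feedforward N w t‖ ≤ Z :=
    fun N hN t ht => norm_feedforward_le_of_mem_feasible hW hw hκ.le hγ₀ hγ₁ ht hN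
  have hsurr : ∀ N ∈ feasible H d₁ d₂ κ γ, ∀ t ≤ T + 1,
      ‖surrogateState A B K w t N‖ ≤ D ∧ ‖surrogateAction A B K w t N‖ ≤ D := by
    intro N hN t ht
    have h1 := hK.norm_surrogateState_le hB hW hw hZ0 (hff N hN) ht
    have h2 : ‖surrogateAction A B K w t N‖ ≤ κ * X + Z := norm_add_le_of_le
      (by rw [norm_neg]; exact norm_app_le_of_le hKκ h1) (hff N hN t ht)
    refine ⟨h1.trans ?_, h2.trans ?_⟩
    · show X ≤ D
      rw [hD]; have := mul_nonneg hκ.le hX0; linarith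
    · rw [hD]; linarith
  obtain ⟨M₁, hM₁, hinit⟩ := h.param_init
  have hinit' : ∀ i, M i 1 ∈ feasible H d₁ d₂ κ γ := fun i => by rwa [hinit i]
  have hstep : ∀ i, ∀ t ∈ Finset.Icc 1 T, IsProjection (feasible H d₁ d₂ κ γ)
      ((∑ j, P j i • M j t) - η • g i t) (M i (t + 1)) := by
    intro i t ht
    have hu := h.update i t ht
    rwa [h.surrogateCost_eq i ((Finset.mem_Icc.1 ht).2.trans (Nat.le_succ T))] at hu
  have hmem : ∀ i, ∀ t ∈ Finset.Icc 1 (T + 1), M i t ∈ feasible H d₁ d₂ κ γ :=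
    fun i t ht => mem_of_isProjection hinit' hstep i ht
  have hmem' : ∀ i, ∀ t ∈ Finset.Icc 1 T, M i t ∈ feasible H d₁ d₂ κ γ := fun i t ht =>
    hmem i t (Finset.Icc_subset_Icc_right (Nat.le_succ T) ht)
  have hle : ∀ t ∈ Finset.Icc 1 T, t ≤ T + 1 := fun t ht =>
    (Finset.mem_Icc.1 ht).2.trans (Nat.le_succ T)
  have hgrad : ∀ i k, ∀ t ∈ Finset.Icc 1 T,
      ‖gradient (surrogateCost A B K w (c i t) t) (M k t)‖ ≤ gb := by
    intro i k t ht
    obtain ⟨hy, hv⟩ := hsurr _ (hmem' k t ht) t (hle t ht)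
    refine ((hc i t ht).norm_gradient_surrogateCost_le hK hB hW hw (hle t ht) hy hv).trans_eq ?_
    rw [hgb, hg₀def, gradientBound]; ring
  have hconv : Convex ℝ (feasible H d₁ d₂ κ γ) := convex_feasible
  have hcons : ∀ t ∈ Finset.Icc 1 T, ∀ i k, ‖M i t - M k t‖ ≤ R := by
    intro t ht i k
    refine (norm_sub_le_deviation (fun i => M i t) i k).trans ?_
    have hdev := hP.deviation_le_of_isProjection hconv hη.le hgb0 ⟨M₁, hM₁, hinit⟩ hstep
      (fun i t ht => hgrad i i t ht) (Finset.mem_Icc.1 ht).1 (hle t ht)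
    refine (mul_le_mul_of_nonneg_left hdev zero_le_two).trans_eq ?_
    rw [hR, hbdef]; ring
  have hR0 : 0 ≤ R := by positivity
  have hΔ0 : 0 ≤ Δ := by positivity
  have hdrift : ∀ t ∈ Finset.Icc 1 T, ‖M j (t + 1) - M j t‖ ≤ Δ := by
    intro t ht
    have h1 := hP.norm_step_sub_mix_le hconv hη.le hinit' hstep (fun i t ht => hgrad i i t ht) j ht
    have h2 := hP.norm_mix_sub_le (z := fun k => M k t) (fun k => hcons t ht k j) j
    have h3 : M j (t + 1) - M j t =
        (M j (t + 1) - ∑ k, P k j • M k t) + (∑ k, P k j • M k t - M j t) := by abel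
    rw [h3]
    exact norm_add_le_of_le h1 h2
  set E₁ := G * D * ((1 + κ) * (κ ^ 3 * ((W * √H * Δ) / γ ^ 2) + X * ρ)) with hE₁
  -- First gap. The surrogate freezes the current `M j t`, while the input at time `s` used `M j s`,
  -- at distance at most `Δ (t - s)`.
  have htrack : ∀ i, ∀ t ∈ Finset.Icc 1 T,
      c i t (pair (x j t) (u j t)) - surrogateCost A B K w (c i t) t (M j t) ≤ E₁ := by
    intro i t ht
    have ht1 := (Finset.mem_Icc.1 ht).1
    have hx := hK.norm_state_le (V := W + κ * Z) (by positivity) (h.state_init j)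
      (fun s hs => h.state_succ j hs) (fun s hs => norm_add_le_of_le (hw s hs)
        (norm_app_le_of_le hB (hff _ (hmem' j s hs) s (hle s hs)))) ht1 (hle t ht)
    change ‖x j t‖ ≤ X at hx
    have hu : ‖u j t‖ ≤ κ * X + Z := by
      rw [h.control_eq j ht]
      refine norm_add_le_of_le ?_ (hff _ (hmem' j t ht) t (hle t ht))
      rw [norm_neg]; exact norm_app_le_of_le hKκ hx
    have herr := hK.norm_state_sub_surrogateState_le hB hW hw hZ0 (hff _ (hmem' j t ht))
      (h.state_init j) (fun s hs => h.state_succ j hs) ht1 (hle t ht) (a := 0)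
      (b := W * √H * Δ) le_rfl (by positivity) (by
        intro s hs hst
        refine (norm_feedforward_sub_le hW hw (by have := hle t ht; omega) _ _).trans ?_
        rw [zero_add, mul_assoc (W * √H)]
        exact mul_le_mul_of_nonneg_left
          (norm_sub_le_of_norm_step_le hdrift hs hst.le (hle t ht)) (by positivity))
    have herr' : ‖x j t - surrogateState A B K w t (M j t)‖ ≤
        κ ^ 3 * ((W * √H * Δ) / γ ^ 2) + X * ρ := by
      refine herr.trans ?_
      rw [zero_div, zero_add]
      have : κ ^ 2 * (W + κ * Z) * (1 - γ) ^ (H + 1) / γ = X * (1 - γ) ^ (H + 1) := by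
        rw [hXdef, stateBound]; ring
      rw [this]
      gcongr
    have hp := norm_pair_sub_surrogatePair_le hKκ herr'
      (z := feedforward (M j t) w t) (a := 0) (by simp)
    rw [← h.control_eq j ht, add_zero] at hp
    refine ((hc i t ht).sub_le (D := D) ?_ ?_ _).trans
      (mul_le_mul_of_nonneg_left hp (by positivity))
    · rw [hD]; have := mul_nonneg hκ.le hX0; linarith
    · rw [hD]; linarith
  -- Second gap: agent `j` pays the cost of agent `i`, which only agent `i` descends on.
  have hexch : ∀ i, ∀ t ∈ Finset.Icc 1 T, surrogateCost A B K w (c i t) t (M j t) -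
      surrogateCost A B K w (c i t) t (M i t) ≤ gb * R := by
    intro i t ht
    refine ((hc i t ht).surrogateCost_sub_le hK hB hW hw (hle t ht) _ _).trans ?_
    exact (real_inner_le_norm _ _).trans
      (mul_le_mul (hgrad i j t ht) (hcons t ht j i) (norm_nonneg _) hgb0)
  have hlearn : ∀ i, ∀ t ∈ Finset.Icc 1 T, surrogateCost A B K w (c i t) t (M i t) -
      surrogateCost A B K w (c i t) t N ≤ inner ℝ (g i t) (M i t - N) := fun i t ht =>
    (hc i t ht).surrogateCost_sub_le hK hB hW hw (hle t ht) _ _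
  set E₂ := G * D * ((1 + κ) * (κ ^ 3 * (Z * ρ / γ) + X * ρ) + Z * ρ) with hE₂
  -- Fourth gap, with two sources of tail error: the imitated control and the truncated surrogate
  -- state.
  have hcomp : ∀ i, ∀ t ∈ Finset.Icc 1 T, surrogateCost A B K w (c i t) t N -
      c i t (pair (linearState A B w K' t) (-app K' (linearState A B w K' t))) ≤ E₂ := by
    intro i t ht
    have ht1 := (Finset.mem_Icc.1 ht).1
    have hzerr : ∀ s, 1 ≤ s → s ≤ T + 1 →
        ‖app (K - K') (linearState A B w K' s) - feedforward N w s‖ ≤ Z * ρ := by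
      intro s hs1 hs2
      refine (hK.norm_sub_feedforward_imitation_le hK' hW hw hs1 hs2).trans_eq ?_
      rw [hZdef, feedforwardBound]; ring
    have herr := hK.norm_state_sub_surrogateState_le hB hW hw hZ0 (hff _ hNmem)
      (x := linearState A B w K') (z := fun s => app (K - K') (linearState A B w K' s))
      (by simp [linearState]) (fun s hs => linearState_succ_eq K (Finset.mem_Icc.1 hs).1) ht1
      (hle t ht) (a := Z * ρ) (b := 0) (by positivity) le_rfl (by
        intro s hs hst
        rw [zero_mul, add_zero]
        exact hzerr s hs (by have := hle t ht; omega))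
    have herr' : ‖linearState A B w K' t - surrogateState A B K w t N‖ ≤
        κ ^ 3 * (Z * ρ / γ) + X * ρ := by
      refine herr.trans ?_
      rw [zero_div, add_zero]
      have : κ ^ 2 * (W + κ * Z) * (1 - γ) ^ (H + 1) / γ = X * (1 - γ) ^ (H + 1) := by
        rw [hXdef, stateBound]; ring
      rw [this]
      gcongr
    have hp := norm_pair_sub_surrogatePair_le hKκ herr' (hzerr t ht1 (hle t ht))
    have hact : -app K (linearState A B w K' t) + app (K - K') (linearState A B w K' t) =
        -app K' (linearState A B w K' t) := by rw [sub_app]; abel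
    rw [hact, norm_sub_rev] at hp
    obtain ⟨hy, hv⟩ := hsurr N hNmem t (hle t ht)
    exact ((hc i t ht).sub_le hy hv _).trans (mul_le_mul_of_nonneg_left hp (by positivity))
  have hreg := hP.regret_le_of_isProjection hconv hη hgb0 hstep (fun i t ht => hgrad i i t ht)
    hcons hNmem
  have hdiam : ∑ i, ‖M i 1 - N‖ ^ 2 ≤ m * (2 * (diameterCoeff d₁ d₂ κ * H)) := by
    have hi : ∀ i ∈ Finset.univ, ‖M i 1 - N‖ ^ 2 ≤ 2 * (diameterCoeff d₁ d₂ κ * H) := by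
      intro i _
      have h1 := norm_sq_le_of_mem_feasible hκ.le hγ₀.le hγ₁ (hinit' i)
      have h2 := norm_sq_le_of_mem_feasible hκ.le hγ₀.le hγ₁ hNmem
      have h3 := _root_.norm_sub_le (M i 1) N
      have h4 : ‖M i 1 - N‖ ^ 2 ≤ 2 * (‖M i 1‖ ^ 2 + ‖N‖ ^ 2) := by
        exact (pow_le_pow_left₀ (norm_nonneg _) h3 2).trans add_sq_le
      rw [diameterCoeff]
      linarith
    simpa using Finset.sum_le_sum hi
  have hround : ∀ t ∈ Finset.Icc 1 T, ∑ i, (c i t (pair (x j t) (u j t)) -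
      c i t (pair (linearState A B w K' t) (-app K' (linearState A B w K' t)))) ≤
      ∑ i, inner ℝ (g i t) (M i t - N) + m * (E₁ + gb * R + E₂) := by
    intro t ht
    have hi : ∀ i ∈ Finset.univ, c i t (pair (x j t) (u j t)) -
        c i t (pair (linearState A B w K' t) (-app K' (linearState A B w K' t))) ≤
        inner ℝ (g i t) (M i t - N) + (E₁ + gb * R + E₂) := fun i _ => by
      linarith [htrack i t ht, hexch i t ht, hlearn i t ht, hcomp i t ht]
    refine (Finset.sum_le_sum hi).trans_eq ?_
    rw [Finset.sum_add_distrib, Finset.sum_const, Finset.card_univ, Fintype.card_fin, nsmul_eq_mul]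
  have htotal : totalCost c T (x j) (u j) - linearCost A B w c T K' ≤
      (m * (2 * (diameterCoeff d₁ d₂ κ * H))) / (2 * η) +
        T * (m * (η * gb ^ 2 / 2 + gb * R)) + T * (m * (E₁ + gb * R + E₂)) := by
    rw [linearCost, totalCost, totalCost, ← Finset.sum_sub_distrib]
    simp only [← Finset.sum_sub_distrib]
    refine (Finset.sum_le_sum hround).trans ?_
    rw [Finset.sum_add_distrib, Finset.sum_const, Nat.card_Icc, Nat.add_sub_cancel, nsmul_eq_mul]
    have hdiam' := div_le_div_of_nonneg_right hdiam (by positivity : 0 ≤ 2 * η)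
    linarith
  refine htotal.trans ?_
  have hH : √(H : ℝ) * √H = H := Real.mul_self_sqrt (by positivity)
  have hgR : gb * R = g₀ ^ 2 * (4 * √m) * (η * H) * b := by
    rw [hR, hgb]
    linear_combination (g₀ ^ 2 * (4 * √m) * η * b) * hH
  have hgg : η * gb ^ 2 / 2 ≤ g₀ ^ 2 * (η * H) * b := by
    have h1 : η * gb ^ 2 / 2 = g₀ ^ 2 * (η * H) / 2 := by
      rw [hgb]; linear_combination (g₀ ^ 2 * η / 2) * hH
    have h0 : 0 ≤ g₀ ^ 2 * (η * H) := by positivity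
    rw [h1]
    linarith [le_mul_of_one_le_right h0 hb1]
  have hΔle : √H * Δ ≤ g₀ * (1 + 4 * √m) * (η * H) * b := by
    have h1 : √H * Δ = g₀ * (η * H) + g₀ * (4 * √m) * (η * H) * b := by
      rw [hΔ, hR, hgb]
      linear_combination (g₀ * η + g₀ * (4 * √m) * η * b) * hH
    have h0 : 0 ≤ g₀ * (η * H) := by positivity
    rw [h1]
    linarith [le_mul_of_one_le_right h0 hb1]
  have hE₁le : E₁ ≤ G * D * ((1 + κ) * (κ ^ 3 * (W * (g₀ * (1 + 4 * √m))) / γ ^ 2)) *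
      (η * H) * b + G * D * ((1 + κ) * X) * ρ := by
    calc E₁ = G * D * ((1 + κ) * (κ ^ 3 * W * (√H * Δ) / γ ^ 2 + X * ρ)) := by rw [hE₁]; ring
      _ ≤ G * D * ((1 + κ) * (κ ^ 3 * W * (g₀ * (1 + 4 * √m) * (η * H) * b) / γ ^ 2 + X * ρ)) := by
          gcongr
      _ = _ := by ring
  -- The term `gb * R` occurs twice, for mixing and for exchanging agents, which gives `8 √m`;
  -- likewise `2 * X` in `truncationCoeff` collects one truncation from `E₁` and one from `E₂`.
  have hround_le : (η * gb ^ 2 / 2 + gb * R) + (E₁ + gb * R + E₂) ≤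
      rateCoeff m κ γ W G * (η * H) * b + truncationCoeff κ γ W G * ρ := by
    have h1 : rateCoeff m κ γ W G = G * D * ((1 + κ) *
        (κ ^ 3 * (W * (g₀ * (1 + 4 * √m))) / γ ^ 2)) + g₀ ^ 2 * (8 * √m + 1) := rfl
    have h2 : truncationCoeff κ γ W G =
        G * D * ((1 + κ) * (κ ^ 3 * (Z / γ) + 2 * X) + Z) := rfl
    have h3 : E₂ = G * D * ((1 + κ) * (κ ^ 3 * (Z / γ) + X) + Z) * ρ := by rw [hE₂]; ring
    rw [h1, h2, h3, hgR]
    linarith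
  have hm0 : (0 : ℝ) ≤ T * m := by positivity
  have hfin := mul_le_mul_of_nonneg_left hround_le hm0
  calc _ = m * (diameterCoeff d₁ d₂ κ * (H / η)) +
        T * m * ((η * gb ^ 2 / 2 + gb * R) + (E₁ + gb * R + E₂)) := by
        field_simp
        ring
    _ ≤ m * (diameterCoeff d₁ d₂ κ * (H / η)) +
        T * m * (rateCoeff m κ γ W G * (η * H) * b + truncationCoeff κ γ W G * ρ) := by linarith
    _ = _ := by rw [hbdef]; ring

end Run

/-! ### Choice of the parameters -/

section Parameters

variable {κ γ W G : ℝ}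

theorem radius_nonneg (hκ : 0 ≤ κ) (hγ : 0 ≤ γ) (hW : 0 ≤ W) : 0 ≤ radius κ γ W := by
  unfold radius stateBound feedforwardBound
  positivity

theorem rateCoeff_nonneg (m : ℕ) (hκ : 0 ≤ κ) (hγ : 0 ≤ γ) (hW : 0 ≤ W) (hG : 0 ≤ G) :
    0 ≤ rateCoeff m κ γ W G := by
  have hr := radius_nonneg hκ hγ hW
  unfold rateCoeff gradientBound
  positivity

theorem truncationCoeff_nonneg (hκ : 0 ≤ κ) (hγ : 0 ≤ γ) (hW : 0 ≤ W) (hG : 0 ≤ G) :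
    0 ≤ truncationCoeff κ γ W G := by
  have hr := radius_nonneg hκ hγ hW
  unfold truncationCoeff stateBound feedforwardBound
  positivity

theorem diameterCoeff_nonneg (d₁ d₂ : ℕ) (κ : ℝ) : 0 ≤ diameterCoeff d₁ d₂ κ := by
  unfold diameterCoeff
  positivity

/-- From `1 - γ ≤ exp (-γ)`; this fixes the threshold `h₀ = 1 / γ`. -/
theorem mul_pow_le_one (hγ₀ : 0 < γ) (hγ₁ : γ ≤ 1) {T H : ℕ} (hT : 0 < T)
    (hH : 1 / γ * Real.log T ≤ H) : T * (1 - γ) ^ H ≤ 1 := by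
  have hT' : (0 : ℝ) < T := by exact_mod_cast hT
  have h1 : (1 - γ) ^ H ≤ Real.exp (-γ) ^ H :=
    pow_le_pow_left₀ (sub_nonneg.2 hγ₁) (Real.one_sub_le_exp_neg γ) H
  have h2 : Real.log T ≤ H * γ := by
    rwa [one_div, inv_mul_le_iff₀ hγ₀, mul_comm] at hH
  have h3 : Real.exp (-γ) ^ H ≤ (T : ℝ)⁻¹ := by
    have h4 : (T : ℝ)⁻¹ = Real.exp (-Real.log T) := by rw [Real.exp_neg, Real.exp_log hT']
    rw [← Real.exp_nat_mul, h4]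
    exact Real.exp_le_exp.2 (by linarith)
  calc (T : ℝ) * (1 - γ) ^ H ≤ T * (T : ℝ)⁻¹ := by
        gcongr
        exact h1.trans h3
    _ = 1 := mul_inv_cancel₀ hT'.ne'

theorem one_le_two_mul_sqrt_mul_log {T : ℕ} (hT : 2 ≤ T) : 1 ≤ 2 * (√(T : ℝ) * Real.log T) := by
  have hT' : (2 : ℝ) ≤ T := by exact_mod_cast hT
  have h1 : 1 ≤ √(T : ℝ) := Real.one_le_sqrt.2 (by linarith)
  have h2 : 1 / 2 ≤ Real.log T := by
    linarith [Real.log_le_log two_pos hT', Real.log_two_gt_d9]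
  nlinarith

end Parameters

end DistControl

/-! ### The main theorem -/

open DistControl in
theorem theorem1 (γ : ℝ) (hγ₀ : 0 < γ) (hγ₁ : γ ≤ 1) :
    ∃ h₀ : ℝ, 0 < h₀ ∧
    ∀ (m d₁ d₂ : ℕ) (κ W Gc η₁ η₂ h₁ h₂ : ℝ),
      0 < η₁ → η₁ ≤ η₂ → h₀ ≤ h₁ → h₁ ≤ h₂ →
    ∃ C : ℝ, 0 < C ∧
    ∀ (A : Matrix (Fin d₁) (Fin d₁) ℝ) (B : Matrix (Fin d₁) (Fin d₂) ℝ)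
      (K : Matrix (Fin d₂) (Fin d₁) ℝ) (P : Matrix (Fin m) (Fin m) ℝ)
      (w : ℕ → Vec d₁) (c : Fin m → ℕ → Pair d₁ d₂ → ℝ) (T H : ℕ) (η : ℝ)
      (x : Fin m → ℕ → Vec d₁) (u : Fin m → ℕ → Vec d₂) (what : Fin m → ℕ → Vec d₁)
      (M : Fin m → ℕ → Param H d₁ d₂),
      IsNetwork P →
      ‖A‖ ≤ κ → ‖B‖ ≤ κ → (∀ t ∈ Finset.Icc 1 T, ‖w t‖ ≤ W) →
      (∀ i, ∀ t ∈ Finset.Icc 1 T, IsCost Gc (c i t)) →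
      StronglyStable κ γ A B K →
      2 ≤ T → 1 ≤ H →
      η₁ / √(T : ℝ) ≤ η → η ≤ η₂ / √(T : ℝ) →
      h₁ * Real.log T ≤ H → (H : ℝ) ≤ h₂ * Real.log T →
      IsRun κ γ η A B K P T w c x u what M →
      secondSingularValue P < 1 ∧
      ∀ j : Fin m, ∃ Kopt : Matrix (Fin d₂) (Fin d₁) ℝ,
        StronglyStable κ γ A B Kopt ∧
        (∀ K' : Matrix (Fin d₂) (Fin d₁) ℝ, StronglyStable κ γ A B K' →
          linearCost A B w c T Kopt ≤ linearCost A B w c T K') ∧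
        totalCost c T (x j) (u j) - linearCost A B w c T Kopt ≤
          C * (√(T : ℝ) * Real.log T) / (1 - secondSingularValue P) ^ 2 := by
  refine ⟨1 / γ, by positivity, ?_⟩
  intro m d₁ d₂ κ W Gc η₁ η₂ h₁ h₂ hη₁ hη₁₂ hh₁ hh₁₂
  set C₀ : ℝ := m * (rateCoeff m κ γ W Gc * (η₂ * h₂) + truncationCoeff κ γ W Gc * 2 +
    diameterCoeff d₁ d₂ κ * (h₂ / η₁)) with hC₀
  -- The constant is chosen before `κ`, `W` and `Gc` are known to be nonnegative, so the sign of
  -- `C₀` is still open.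
  refine ⟨|C₀| + 1, by positivity, ?_⟩
  intro A B K P w c T H η x u what M hP _ hB hw hc hK hT _ hηl hηu hHl hHu hrun
  refine ⟨hP.secondSingularValue_lt_one, fun j => ?_⟩
  obtain ⟨Kopt, hopt, hmin⟩ := exists_isMinOn_linearCost (w := w) hc hK
  refine ⟨Kopt, hopt, hmin, ?_⟩
  have hκ := hK.1.le
  have h1T : 1 ∈ Finset.Icc 1 T := Finset.mem_Icc.2 ⟨le_rfl, by omega⟩
  have hW : 0 ≤ W := (norm_nonneg _).trans (hw 1 h1T)
  have hG : 0 ≤ Gc := by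
    simpa using (norm_nonneg _).trans ((hc j 1 h1T).gradient_le 1 0 0 (by simp) (by simp))
  have hT0 : (0 : ℝ) < T := by exact_mod_cast (by omega : 0 < T)
  have hsqrt : 0 < √(T : ℝ) := Real.sqrt_pos.2 hT0
  have hη : 0 < η := (div_pos hη₁ hsqrt).trans_le hηl
  have hη₂ : 0 ≤ η₂ / √(T : ℝ) := hη.le.trans hηu
  have hlog : 0 ≤ Real.log T := Real.log_natCast_nonneg T
  have hh₂ : 0 ≤ h₂ := (by positivity : 0 ≤ 1 / γ).trans (hh₁.trans hh₁₂)
  set S := √(T : ℝ) * Real.log T with hS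
  set b := (1 - secondSingularValue P)⁻¹ with hb
  have hβ : 0 < 1 - secondSingularValue P := sub_pos.2 hP.secondSingularValue_lt_one
  have hb1 : 1 ≤ b := (one_le_inv₀ hβ).2 (by
    linarith [IsNetwork.secondSingularValue_nonneg (P := P)])
  have hS0 : 0 ≤ S := by positivity
  have hrate : (T : ℝ) * (η * H) ≤ η₂ * h₂ * S := by
    calc (T : ℝ) * (η * H) ≤ T * (η₂ / √(T : ℝ) * (h₂ * Real.log T)) := by gcongr
      _ = η₂ * h₂ * (T / √(T : ℝ) * Real.log T) := by ring
      _ = η₂ * h₂ * S := by rw [Real.div_sqrt, hS]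
  have htrunc : (T : ℝ) * (1 - γ) ^ H ≤ 2 * S :=
    (mul_pow_le_one hγ₀ hγ₁ (by omega) ((mul_le_mul_of_nonneg_right hh₁ hlog).trans hHl)).trans
      (one_le_two_mul_sqrt_mul_log hT)
  have hdiam : (H : ℝ) / η ≤ h₂ / η₁ * S := by
    calc (H : ℝ) / η ≤ h₂ * Real.log T / (η₁ / √(T : ℝ)) := by gcongr
      _ = h₂ / η₁ * S := by rw [hS]; field_simp
  have h1 := mul_le_mul_of_nonneg_left hrate (rateCoeff_nonneg m hκ hγ₀.le hW hG)
  have h2 := mul_le_mul_of_nonneg_left htrunc (truncationCoeff_nonneg hκ hγ₀.le hW hG)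
  have h3 := mul_le_mul_of_nonneg_left hdiam (diameterCoeff_nonneg d₁ d₂ κ)
  -- Since `b ≥ 1`, all three terms, of order `b` or `1`, are absorbed into `b ^ 2`.
  have hb2 : b ≤ b ^ 2 := by nlinarith
  have hb3 : 1 ≤ b ^ 2 := hb1.trans hb2
  have hc1 : 0 ≤ rateCoeff m κ γ W Gc * (η₂ * h₂ * S) := by
    have := rateCoeff_nonneg m hκ hγ₀.le hW hG
    have := hη₁.le.trans hη₁₂
    positivity
  have hc2 : 0 ≤ truncationCoeff κ γ W Gc * (2 * S) := by
    have := truncationCoeff_nonneg hκ hγ₀.le hW hG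
    positivity
  have hc3 : 0 ≤ diameterCoeff d₁ d₂ κ * (h₂ / η₁ * S) := by
    have := diameterCoeff_nonneg d₁ d₂ κ
    positivity
  calc _ ≤ _ := hrun.regret_le hP hB hW hw hc hG hK hη hopt j
    _ ≤ m * (rateCoeff m κ γ W Gc * (η₂ * h₂ * S) * b + truncationCoeff κ γ W Gc * (2 * S) +
        diameterCoeff d₁ d₂ κ * (h₂ / η₁ * S)) := by
        rw [div_eq_mul_inv]
        gcongr
    _ ≤ m * (rateCoeff m κ γ W Gc * (η₂ * h₂ * S) * b ^ 2 +
        truncationCoeff κ γ W Gc * (2 * S) * b ^ 2 +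
        diameterCoeff d₁ d₂ κ * (h₂ / η₁ * S) * b ^ 2) := by
        refine mul_le_mul_of_nonneg_left (add_le_add (add_le_add ?_ ?_) ?_) (Nat.cast_nonneg m)
        · exact mul_le_mul_of_nonneg_left hb2 hc1
        · exact le_mul_of_one_le_right hc2 hb3
        · exact le_mul_of_one_le_right hc3 hb3
    _ = C₀ * (S * b ^ 2) := by rw [hC₀]; ring
    _ ≤ (|C₀| + 1) * (S * b ^ 2) := by
        gcongr
        linarith [le_abs_self C₀]
    _ = (|C₀| + 1) * S / (1 - secondSingularValue P) ^ 2 := by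
        rw [hb, inv_pow, div_eq_mul_inv]; ring
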